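/- Let $G$ be a finite simple graph and let $e=(u,v)$ be an edge of $G$. Write $\mathrm{Ind}(G)$ for (the geometric realization of) the independence complex of $G$, i.e. the simplicial complex on $V(G)$ whose simplices are the nonempty independent sets of $G$ (so $\mathrm{Ind}$ of the graph without vertices is the empty space). Put $N[u]=\{u\}\cup\{w: w \text{ adjacent to } u\}$, $N[e]=N[u]\cup N[v]$; let $G\setminus N[e]$ be the subgraph of $G$ induced on the complement of $N[e]$, let $e\sqcup(G\setminus N[e])$ be the subgraph of $G$ induced on $\{u,v\}\cup(V(G)\setminus N[e])$, and let $G-e$ be $G$ with the edge $e$ removed. Let $\Sigma$ denote the unreduced suspension (with $\Sigma\emptyset=S^0$), and let $$\iota:\mathrm{Ind}(e\sqcup(G\setminus N[e]))\hookrightarrow\mathrm{Ind}(G),\qquad j:\mathrm{Ind}(G)\hookrightarrow\mathrm{Ind}(G-e)$$ be the natural inclusions. Then there is a continuous map $\delta:\mathrm{Ind}(G-e)\to\Sigma\,\mathrm{Ind}(e\sqcup(G\setminus N[e]))$ such that the infinite sequence $$\mathrm{Ind}(e\sqcup(G\setminus N[e]))\xrightarrow{\iota}\mathrm{Ind}(G)\xrightarrow{j}\mathrm{Ind}(G-e)\xrightarrow{\delta}\Sigma\,\mathrm{Ind}(e\sqcup(G\setminus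 N[e]))\xrightarrow{\Sigma\iota}\Sigma\,\mathrm{Ind}(G)\xrightarrow{\Sigma j}\Sigma\,\mathrm{Ind}(G-e)\xrightarrow{\Sigma\delta}\cdots$$ is a cofibre sequence. This means that it is, up to homotopy, the Puppe sequence $A\xrightarrow{\iota}X\hookrightarrow C(\iota)\to\Sigma A\xrightarrow{\Sigma\iota}\Sigma X\to\Sigma C(\iota)\to\cdots$ of $\iota$, where $A=\mathrm{Ind}(e\sqcup(G\setminus N[e]))$, $X=\mathrm{Ind}(G)$ and $C(\iota)$ is the mapping cone: there is a map $C(\iota)\to\mathrm{Ind}(G-e)$ which, together with the identities of $A$ and $X$ and the iterated suspensions of these three maps, forms a ladder from the Puppe sequence to the sequence above in which all vertical maps are homotopy equivalences and all squares commute up to homotopy. Moreover: (a) If $\mathrm{Ind}(G\setminus N[e])$ is contractible, then $j$ is a homotopy equivalence. In particular, $j$ is a homotopy equivalence whenever $e$ is isolating, i.e. whenever $G\setminus N[e]$ has an isolated vertex. (b) If $\iota$ is null-homotopic, then there is a splitting $$\mathrm{Ind}(G-e)\simeq\mathrm{Ind}(G)\vee\Sigma^2\,\mathrm{Ind}(G\setminus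 N[e]),$$ where the base point of $\mathrm{Ind}(G)$ is any point of the path component that contains the image of $\iota$, and the base point of $\Sigma^2\,\mathrm{Ind}(G\setminus N[e])$ is arbitrary; the equivalence can be chosen so that its restriction to the summand $\mathrm{Ind}(G)$ is homotopic to $j$. -/

import Mathlib

noncomputable section

namespace IndCx

open ContinuousMap unitInterval

universe u

/-! ### Independence complexes and their geometric realizations -/

/-- The independence complex of `G`: its faces are the nonempty finite independent sets. -/
def indComplex {V : Type u} (G : SimpleGraph V) : AbstractSimplicialComplex V where
  faces := {s | s.Nonempty ∧ G.IsIndepSet (s : Set V)}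
  isRelLowerSet_faces := by
    rintro s ⟨hs, hI⟩
    exact ⟨hs, fun t hts ht => ⟨ht, hI.mono (by exact_mod_cast hts)⟩⟩
  singleton_mem v := by simp

/-- The geometric realization of a simplicial complex with finitely many vertices, as a
subspace of `V → ℝ`: points are given by their barycentric coordinates, and the set of vertices
with nonzero coordinate is contained in a face. -/
def realization {V : Type u} (K : AbstractSimplicialComplex V) : Set (V → ℝ) :=
  {p | (∀ v, 0 ≤ p v) ∧ ∃ s ∈ K.faces, (∀ v, v ∉ s → p v = 0) ∧ ∑ v ∈ s, p v = 1}

/-- The topological space `Ind(G)`. -/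
abbrev IndSpace {V : Type u} (G : SimpleGraph V) : Type u := realization (indComplex G)

/-- The continuous map `Ind(H) → Ind(G)` induced by an injection of vertices under which
nonadjacent vertices stay nonadjacent: coordinates are extended by zero. -/
def indMap {W V : Type u} (H : SimpleGraph W) (G : SimpleGraph V) (f : W ↪ V)
    (hf : ∀ a b, G.Adj (f a) (f b) → H.Adj a b) : C(IndSpace H, IndSpace G) where
  toFun p := ⟨Function.extend f p.1 0, by
    obtain ⟨p, hp, s, ⟨hs, hI⟩, h0, h1⟩ := p
    refine ⟨fun v => ?_, s.map f, ⟨hs.map, ?_⟩, fun v hv => ?_, ?_⟩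
    · by_cases h : ∃ a, f a = v
      · obtain ⟨a, rfl⟩ := h
        simpa [f.injective.extend_apply] using hp a
      · simp [Function.extend_apply' _ _ _ h]
    · intro x hx y hy hxy hadj
      simp only [Finset.coe_map, Set.mem_image, Finset.mem_coe] at hx hy
      obtain ⟨a, ha, rfl⟩ := hx
      obtain ⟨b, hb, rfl⟩ := hy
      exact hI ha hb (fun h => hxy (h ▸ rfl)) (hf a b hadj)
    · by_cases h : ∃ a, f a = v
      · obtain ⟨a, rfl⟩ := h
        rw [f.injective.extend_apply]
        exact h0 a (fun ha => hv (Finset.mem_map_of_mem f ha))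
      · simp [Function.extend_apply' _ _ _ h]
    · rw [Finset.sum_map]
      simpa [f.injective.extend_apply] using h1⟩
  continuous_toFun := by
    refine Continuous.subtype_mk (continuous_pi fun v => ?_) _
    by_cases h : ∃ a, f a = v
    · obtain ⟨a, rfl⟩ := h
      simp only [f.injective.extend_apply]
      exact (continuous_apply a).comp continuous_subtype_val
    · simp only [Function.extend_apply' _ _ _ h]
      exact continuous_const

/-! ### Neighbourhoods and edges -/

/-- The closed neighbourhood `N[v]`. -/
def closedNbhd {V : Type u} (G : SimpleGraph V) (v : V) : Set V := {w | w = v ∨ G.Adj v w}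

/-- The closed neighbourhood `N[e] = N[u] ∪ N[v]` of `e = (u, v)`. -/
def edgeNbhd {V : Type u} (G : SimpleGraph V) (u v : V) : Set V :=
  closedNbhd G u ∪ closedNbhd G v

/-- The graph `G ∖ N[e]`. -/
abbrev outside {V : Type u} (G : SimpleGraph V) (u v : V) :
    SimpleGraph ↥((edgeNbhd G u v)ᶜ) :=
  G.induce (edgeNbhd G u v)ᶜ

/-- The graph `e ⊔ (G ∖ N[e])`: the induced subgraph of `G` on `u`, `v` and the vertices outside
`N[e]`. -/
abbrev edgeWithOutside {V : Type u} (G : SimpleGraph V) (u v : V) :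
    SimpleGraph ↥({u, v} ∪ (edgeNbhd G u v)ᶜ : Set V) :=
  G.induce ({u, v} ∪ (edgeNbhd G u v)ᶜ)

/-- The graph `G - e`. -/
abbrev deleteEdge {V : Type u} (G : SimpleGraph V) (u v : V) : SimpleGraph V :=
  G.deleteEdges {s(u, v)}

/-- The edge `e = (u, v)` is isolating if `G ∖ N[e]` has an isolated vertex. -/
def IsIsolatingEdge {V : Type u} (G : SimpleGraph V) (u v : V) : Prop :=
  G.Adj u v ∧ ∃ w, (outside G u v).IsIsolated w

/-- The natural inclusion `Ind(e ⊔ (G ∖ N[e])) ↪ Ind(G)`. -/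
def inclEdge {V : Type u} (G : SimpleGraph V) (u v : V) :
    C(IndSpace (edgeWithOutside G u v), IndSpace G) :=
  indMap _ _ (Function.Embedding.subtype _) (fun _ _ h => h)

/-- The natural inclusion `Ind(G) ↪ Ind(G - e)`. -/
def inclDelete {V : Type u} (G : SimpleGraph V) (u v : V) :
    C(IndSpace G, IndSpace (deleteEdge G u v)) :=
  indMap _ _ (Function.Embedding.refl V) (fun _ _ h => SimpleGraph.deleteEdges_le _ h)

/-! ### Suspensions, mapping cones, wedges -/

section Constructions

variable {A X Y Z : Type u} [TopologicalSpace A] [TopologicalSpace X] [TopologicalSpace Y]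
  [TopologicalSpace Z]

/-- The gluing relation of the unreduced suspension; the two poles are `false` and `true`. -/
inductive SuspRel (A : Type u) : (A × I) ⊕ Bool → (A × I) ⊕ Bool → Prop
  | bot (a : A) : SuspRel A (Sum.inl (a, 0)) (Sum.inr false)
  | top (a : A) : SuspRel A (Sum.inl (a, 1)) (Sum.inr true)

/-- The unreduced suspension `Σ A`; the suspension of the empty space consists of two points. -/
def Susp (A : Type u) : Type u := Quot (SuspRel A)

instance : TopologicalSpace (Susp A) := inferInstanceAs (TopologicalSpace (Quot (SuspRel A)))

/-- The suspension `Σ f` of a continuous map. -/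
def Susp.map (f : C(A, X)) : C(Susp A, Susp X) where
  toFun := Quot.map (Sum.map (Prod.map f id) id) (by
    rintro _ _ (a | a)
    · exact SuspRel.bot (f a)
    · exact SuspRel.top (f a))
  continuous_toFun := continuous_quot_map _ (by fun_prop)

/-- The gluing relation of the mapping cone: `f a ∼ (a, 1)` and `(a, 0) ∼ (a', 0)`. -/
inductive ConeRel (f : C(A, X)) : X ⊕ (A × I) → X ⊕ (A × I) → Prop
  | base (a : A) : ConeRel f (Sum.inl (f a)) (Sum.inr (a, 1))
  | apex (a a' : A) : ConeRel f (Sum.inr (a, 0)) (Sum.inr (a', 0))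

/-- The mapping cone (homotopy cofibre) `C(f)` of a map out of a nonempty space. -/
def MappingCone (f : C(A, X)) : Type u := Quot (ConeRel f)

instance (f : C(A, X)) : TopologicalSpace (MappingCone f) :=
  inferInstanceAs (TopologicalSpace (Quot (ConeRel f)))

/-- The inclusion `X ↪ C(f)`. -/
def MappingCone.incl (f : C(A, X)) : C(X, MappingCone f) where
  toFun x := Quot.mk _ (Sum.inl x)
  continuous_toFun := continuous_quot_mk.comp continuous_inl

/-- The map `C(f) → Σ A` which collapses `X` to a pole. -/
def MappingCone.pinch (f : C(A, X)) : C(MappingCone f, Susp A) where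
  toFun := Quot.lift
    (Sum.elim (fun _ => Quot.mk _ (Sum.inr true)) (fun q => Quot.mk _ (Sum.inl q))) (by
      rintro _ _ (a | ⟨a, a'⟩)
      · exact (Quot.sound (SuspRel.top a)).symm
      · exact (Quot.sound (SuspRel.bot a)).trans (Quot.sound (SuspRel.bot a')).symm)
  continuous_toFun := continuous_quot_lift _
    (continuous_const.sumElim (continuous_quot_mk.comp continuous_inl))

/-- The gluing relation of the wedge sum. -/
inductive WedgeRel (x : X) (y : Y) : X ⊕ Y → X ⊕ Y → Prop
  | glue : WedgeRel x y (Sum.inl x) (Sum.inr y)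

/-- The wedge sum `X ∨ Y` with respect to the base points `x` and `y`. -/
def Wedge (x : X) (y : Y) : Type u := Quot (WedgeRel x y)

instance (x : X) (y : Y) : TopologicalSpace (Wedge x y) :=
  inferInstanceAs (TopologicalSpace (Quot (WedgeRel x y)))

/-- The inclusion of the first summand `X ↪ X ∨ Y`. -/
def Wedge.inl (x : X) (y : Y) : C(X, Wedge x y) where
  toFun a := Quot.mk _ (Sum.inl a)
  continuous_toFun := continuous_quot_mk.comp continuous_inl

/-- A continuous map is a homotopy equivalence. -/
def IsHomotopyEquiv (f : C(X, Y)) : Prop := ∃ h : X ≃ₕ Y, h.toFun = f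

end Constructions

/-! ### Cofibre sequences -/

/-- The `n`-th space of the infinite sequence `A, X, Y, ΣA, ΣX, ΣY, Σ²A, …`. -/
def longObj : ℕ → TopCat.{u} → TopCat.{u} → TopCat.{u} → TopCat.{u}
  | 0, A, _, _ => A
  | 1, _, X, _ => X
  | 2, _, _, Y => Y
  | n + 3, A, X, Y => longObj n (TopCat.of (Susp A)) (TopCat.of (Susp X)) (TopCat.of (Susp Y))

/-- The `n`-th map of the infinite sequence
`A →[f] X →[g] Y →[h] ΣA →[Σf] ΣX →[Σg] ΣY →[Σh] Σ²A ⟶ ⋯`. -/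
def longMap : ∀ (n : ℕ) {A X Y : TopCat.{u}} (_ : C(A, X)) (_ : C(X, Y)) (_ : C(Y, Susp A)),
    C(longObj n A X Y, longObj (n + 1) A X Y)
  | 0, _, _, _, f, _, _ => f
  | 1, _, _, _, _, g, _ => g
  | 2, _, _, _, _, _, h => h
  | n + 3, _, _, _, f, g, h =>
    longMap n (A := TopCat.of _) (X := TopCat.of _) (Y := TopCat.of _)
      (Susp.map f) (Susp.map g) (Susp.map h)

/-- The sequence of vertical maps `a, b, c, Σa, Σb, Σc, Σ²a, …` between two such infinite
sequences of spaces. -/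
def longVert : ∀ (n : ℕ) {A X Y A' X' Y' : TopCat.{u}} (_ : C(A, A')) (_ : C(X, X'))
    (_ : C(Y, Y')), C(longObj n A X Y, longObj n A' X' Y')
  | 0, _, _, _, _, _, _, a, _, _ => a
  | 1, _, _, _, _, _, _, _, b, _ => b
  | 2, _, _, _, _, _, _, _, _, c => c
  | n + 3, _, _, _, _, _, _, a, b, c =>
    longVert n (A := TopCat.of _) (X := TopCat.of _) (Y := TopCat.of _)
      (A' := TopCat.of _) (X' := TopCat.of _) (Y' := TopCat.of _)
      (Susp.map a) (Susp.map b) (Susp.map c)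

/-- The infinite sequence `A →[f] X →[g] Y →[h] ΣA →[Σf] ΣX →[Σg] ΣY →[Σh] ⋯`
is a cofibre sequence: up to homotopy it is the Puppe sequence
`A →[f] X ↪ C(f) ⟶ ΣA →[Σf] ΣX ⟶ ΣC(f) ⟶ ⋯` of `f`. That is, there is a ladder from the
Puppe sequence to it, given by the identities of `A`, `X`, a map `C(f) → Y`, and the iterated
suspensions of these, in which all vertical maps are homotopy equivalences and all squares
commute up to homotopy. -/
def IsCofibreSequence {A X Y : TopCat.{u}} (f : C(A, X)) (g : C(X, Y)) (h : C(Y, Susp A)) :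
    Prop :=
  ∃ φ : C(TopCat.of (MappingCone f), Y), ∀ n : ℕ,
    IsHomotopyEquiv (longVert n (ContinuousMap.id A) (ContinuousMap.id X) φ) ∧
    Homotopic
      ((longMap n f g h).comp (longVert n (ContinuousMap.id A) (ContinuousMap.id X) φ))
      ((longVert (n + 1) (ContinuousMap.id A) (ContinuousMap.id X) φ).comp
        (longMap n (Y := TopCat.of (MappingCone f)) f (MappingCone.incl f)
          (MappingCone.pinch f)))

end IndCx

end

/-! A point of `Ind(G - e)` lies outside `Ind(G)` exactly when its coordinates at `u` and `v` are
both positive. It is then supported in `e` and `G ∖ N[e]`, and subtracting the multiple of the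
midpoint of `e` that kills the smaller of these two coordinates lands, after rescaling, in `Ind(e ⊔
(G ∖ N[e]))`. So `Ind(G - e)` is `Ind(G)` with a cone over `Ind(e ⊔ (G ∖ N[e]))` attached, the
midpoint being the apex: it is homeomorphic under `Ind(G)` to the mapping cone of `ι`
(`exists_homeomorph_mappingCone`). With `δ` the pinch map read through this homeomorphism, all
squares of the ladder commute strictly.

In `e ⊔ (G ∖ N[e])` every vertex off `e` is nonadjacent to `u` and `v`, so its independence complex
is the join of the two points `u`, `v` with `Ind(G ∖ N[e])`, that is, a suspension
(`exists_homeomorph_susp`). If `Ind(G ∖ N[e])` is contractible, so is this suspension, and attaching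
a cone over a contractible space does not change the homotopy type (`isHomotopyEquiv_incl`). This is
(a).

For (b), homotopic maps have equivalent mapping cones (`equivUnder_of_homotopic`), and the cone of a
constant map is a wedge with a suspension (`equivUnder_incl_const`). The free choice of base points
rests on the homotopy extension property of points (`pointHEP`). The relation `EquivUnder` keeps
track of the map from `Ind(G)` along the chain of equivalences. -/

noncomputable section

namespace IndCx

open ContinuousMap unitInterval

universe u

/-! ### Mapping cones and wedges: universal properties and homotopy invariance -/

section Topology

variable {A B X Y Z P Q R : Type u} [TopologicalSpace A] [TopologicalSpace B] [TopologicalSpace X]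
  [TopologicalSpace Y] [TopologicalSpace Z] [TopologicalSpace P] [TopologicalSpace Q]
  [TopologicalSpace R]

/-- The retraction of the real line onto the unit interval. -/
def clamp (t : ℝ) : I := Set.projIcc 0 1 zero_le_one t

@[continuity, fun_prop]
theorem continuous_clamp : Continuous clamp := continuous_projIcc (h := zero_le_one)

@[simp] theorem clamp_coe (t : I) : clamp t = t := Set.projIcc_val _ t

theorem clamp_of_le_zero {t : ℝ} (h : t ≤ 0) : clamp t = 0 := Set.projIcc_of_le_left _ h

theorem clamp_of_one_le {t : ℝ} (h : 1 ≤ t) : clamp t = 1 := Set.projIcc_of_right_le _ h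

@[simp] theorem clamp_zero : clamp 0 = 0 := clamp_of_le_zero le_rfl

@[simp] theorem clamp_one : clamp 1 = 1 := clamp_of_one_le le_rfl

theorem coe_clamp {t : ℝ} (h0 : 0 ≤ t) (h1 : t ≤ 1) : (clamp t : ℝ) = t := by
  simp [clamp, Set.coe_projIcc, h0, h1]

/-! ### Homotopy equivalences under a space -/

/-- There is a homotopy equivalence from `P` to `Q` which is, up to homotopy, compatible with maps
from `X` to `P` and `Q`. -/
def EquivUnder (i : C(X, P)) (j : C(X, Q)) : Prop :=
  ∃ Φ : ContinuousMap.HomotopyEquiv P Q, (Φ.toFun.comp i).Homotopic j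

theorem EquivUnder.symm {i : C(X, P)} {j : C(X, Q)} (h : EquivUnder i j) : EquivUnder j i := by
  obtain ⟨Φ, hΦ⟩ := h
  refine ⟨Φ.symm, ?_⟩
  have h1 : (Φ.invFun.comp (Φ.toFun.comp i)).Homotopic (Φ.invFun.comp j) :=
    (Homotopic.refl _).comp hΦ
  have h2 : ((Φ.invFun.comp Φ.toFun).comp i).Homotopic ((ContinuousMap.id P).comp i) :=
    Φ.left_inv.comp (Homotopic.refl _)
  exact h1.symm.trans h2

theorem EquivUnder.trans {i : C(X, P)} {j : C(X, Q)} {k : C(X, R)} (h : EquivUnder i j)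
    (h' : EquivUnder j k) : EquivUnder i k := by
  obtain ⟨Φ, hΦ⟩ := h
  obtain ⟨Ψ, hΨ⟩ := h'
  have h1 : (Ψ.toFun.comp (Φ.toFun.comp i)).Homotopic (Ψ.toFun.comp j) :=
    (Homotopic.refl _).comp hΦ
  exact ⟨Φ.trans Ψ, h1.trans hΨ⟩

/-! ### Maps out of mapping cones and wedges -/

namespace MappingCone

/-- The canonical map from the cone on `A` to the mapping cone. -/
def cone (f : C(A, X)) : C(A × I, MappingCone f) where
  toFun q := Quot.mk _ (Sum.inr q)
  continuous_toFun := continuous_quot_mk.comp continuous_inr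

theorem cone_one (f : C(A, X)) (a : A) : cone f (a, 1) = incl f (f a) :=
  (Quot.sound (ConeRel.base a)).symm

theorem cone_zero (f : C(A, X)) (a a' : A) : cone f (a, 0) = cone f (a', 0) :=
  Quot.sound (ConeRel.apex a a')

/-- The universal property of the mapping cone. -/
def desc {f : C(A, X)} (g : C(X, Z)) (k : C(A × I, Z)) (h1 : ∀ a, k (a, 1) = g (f a))
    (h0 : ∀ a a', k (a, 0) = k (a', 0)) : C(MappingCone f, Z) where
  toFun := Quot.lift (Sum.elim g k) (by
    rintro _ _ (a | ⟨a, a'⟩)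
    · exact (h1 a).symm
    · exact h0 a a')
  continuous_toFun := continuous_quot_lift _ (g.continuous.sumElim k.continuous)

@[simp] theorem desc_cone {f : C(A, X)} (g : C(X, Z)) (k : C(A × I, Z)) (h1 h0) (q : A × I) :
    (desc (f := f) g k h1 h0) (cone f q) = k q := rfl

theorem ind {f : C(A, X)} {p : MappingCone f → Prop} (h1 : ∀ x, p (incl f x))
    (h2 : ∀ q, p (cone f q)) (z : MappingCone f) : p z := by
  obtain ⟨x | q⟩ := z
  exacts [h1 x, h2 q]

/-- A homotopy is treated as a map into the path space `C(I, Z)`, where the universal property of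
the quotient applies directly; currying back is continuous since `I` is locally compact. -/
theorem homotopic_of {f : C(A, X)} {F F' : C(MappingCone f, Z)} (g : C(X, C(I, Z)))
    (k : C((A × I) × I, Z)) (h1 : ∀ a s, k ((a, 1), s) = g (f a) s)
    (h0 : ∀ a a' s, k ((a, 0), s) = k ((a', 0), s))
    (g0 : ∀ x, g x 0 = F (incl f x)) (g1 : ∀ x, g x 1 = F' (incl f x))
    (k0 : ∀ q, k (q, 0) = F (cone f q)) (k1 : ∀ q, k (q, 1) = F' (cone f q)) :
    Homotopic F F' := by
  let K : C(MappingCone f, C(I, Z)) := desc g k.curry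
    (fun a => by ext s; exact h1 a s) (fun a a' => by ext s; exact h0 a a' s)
  refine ⟨⟨K.uncurry.comp (ContinuousMap.prodSwap), fun z => ?_, fun z => ?_⟩⟩
  · exact ind (p := fun z => K z 0 = F z) g0 k0 z
  · exact ind (p := fun z => K z 1 = F' z) g1 k1 z

end MappingCone

namespace Wedge

variable {x : X} {y : Y}

/-- The inclusion of the second summand. -/
def inr (x : X) (y : Y) : C(Y, Wedge x y) where
  toFun a := Quot.mk _ (Sum.inr a)
  continuous_toFun := continuous_quot_mk.comp continuous_inr

theorem glue (x : X) (y : Y) : inl x y x = inr x y y := Quot.sound WedgeRel.glue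

/-- The universal property of the wedge. -/
def desc (g : C(X, Z)) (k : C(Y, Z)) (h : g x = k y) : C(Wedge x y, Z) where
  toFun := Quot.lift (Sum.elim g k) (by
    rintro _ _ ⟨⟩
    exact h)
  continuous_toFun := continuous_quot_lift _ (g.continuous.sumElim k.continuous)

theorem ind {p : Wedge x y → Prop} (h1 : ∀ a, p (inl x y a))
    (h2 : ∀ b, p (inr x y b)) (z : Wedge x y) : p z := by
  obtain ⟨a | b⟩ := z
  exacts [h1 a, h2 b]

theorem homotopic_of {F F' : C(Wedge x y, Z)} (g : C(X × I, Z)) (k : C(Y × I, Z))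
    (h : ∀ s, g (x, s) = k (y, s))
    (g0 : ∀ a, g (a, 0) = F (inl x y a)) (g1 : ∀ a, g (a, 1) = F' (inl x y a))
    (k0 : ∀ b, k (b, 0) = F (inr x y b)) (k1 : ∀ b, k (b, 1) = F' (inr x y b)) :
    Homotopic F F' := by
  let K : C(Wedge x y, C(I, Z)) := desc g.curry k.curry (by ext s; exact h s)
  refine ⟨⟨K.uncurry.comp (ContinuousMap.prodSwap), fun z => ?_, fun z => ?_⟩⟩
  · exact ind (p := fun z => K z 0 = F z) g0 k0 z
  · exact ind (p := fun z => K z 1 = F' z) g1 k1 z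

end Wedge

/-! ### Mapping cones of homotopic maps -/

namespace MappingCone

variable {f g : C(A, X)}

/-- The cylinder of a homotopy `K : f ≃ g`, attached to the cone on `A` in the mapping cone
of `f`. -/
def thread (K : Homotopy f g) : C(A × ℝ, MappingCone f) where
  toFun q := if q.2 ≤ 1 then cone f (q.1, clamp q.2) else incl f (K (clamp (q.2 - 1), q.1))
  continuous_toFun := by
    refine Continuous.if_le (by fun_prop) (by fun_prop) (by fun_prop) (by fun_prop) ?_
    rintro ⟨a, t⟩ (rfl : t = 1)
    simp [cone_one]

theorem thread_of_le (K : Homotopy f g) (a : A) {t : ℝ} (h : t ≤ 1) :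
    thread K (a, t) = cone f (a, clamp t) := if_pos h

theorem thread_of_ge (K : Homotopy f g) (a : A) {t : ℝ} (h : 1 ≤ t) :
    thread K (a, t) = incl f (K (clamp (t - 1), a)) := by
  rcases h.eq_or_lt with rfl | h
  · simp [thread_of_le, cone_one]
  · exact if_neg (not_le.2 h)

/-- The map of mapping cones under `X` defined by a homotopy of maps. -/
def shift (K : Homotopy g f) : C(MappingCone f, MappingCone g) :=
  -- The factor 2 makes the cone coordinate run through `[0, 2]`: the cone of `g` on `[0, 1]`, then
  -- the homotopy from `g` to `f` on `[1, 2]`.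
  desc (incl g) ((thread K).comp ⟨fun q => (q.1, 2 * (q.2 : ℝ)), by fun_prop⟩)
    (fun a => by
      simp only [ContinuousMap.comp_apply, ContinuousMap.coe_mk]
      rw [thread_of_ge _ _ (by norm_num)]
      norm_num)
    (fun a a' => by
      simp only [ContinuousMap.comp_apply, ContinuousMap.coe_mk]
      rw [thread_of_le _ _ (by norm_num), thread_of_le _ _ (by norm_num)]
      simpa using cone_zero g a a')

@[simp] theorem shift_incl (K : Homotopy g f) (x : X) : shift K (incl f x) = incl g x := rfl

theorem shift_cone (K : Homotopy g f) (a : A) (t : I) :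
    shift K (cone f (a, t)) = thread K (a, 2 * t) := rfl

/-- On the ray over `a` the composite runs along `thread K.symm` with parameter `min (4t) (3 - 2t)`:
up to the far end 2 of the homotopy and back to 1. Linear interpolation of this parameter with `t`,
which fixes the values at 0 and 1, is the homotopy. -/
theorem shift_symm_comp_shift (K : Homotopy g f) :
    ((shift K.symm).comp (shift K)).Homotopic (ContinuousMap.id (MappingCone f)) := by
  refine homotopic_of
    (ContinuousMap.curry ⟨fun q => incl f q.1, by fun_prop⟩)
    ((thread K.symm).comp
      ⟨fun q => (q.1.1, (1 - (q.2 : ℝ)) * min (4 * (q.1.2 : ℝ)) (3 - 2 * q.1.2) + q.2 * q.1.2),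
        by fun_prop⟩) ?_ ?_ ?_ ?_ ?_ ?_
  · intro a s
    simp only [ContinuousMap.comp_apply, ContinuousMap.coe_mk, ContinuousMap.curry_apply]
    rw [thread_of_ge _ _ (by norm_num)]
    norm_num
  · intro a a' s
    simp only [ContinuousMap.comp_apply, ContinuousMap.coe_mk]
    rw [thread_of_le _ _ (by norm_num), thread_of_le _ _ (by norm_num)]
    norm_num
    exact cone_zero f a a'
  · intro x
    rfl
  · intro x
    rfl
  · rintro ⟨a, t⟩
    simp only [ContinuousMap.comp_apply, ContinuousMap.coe_mk, shift_cone]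
    rcases le_total (2 * (t : ℝ)) 1 with h | h
    · rw [thread_of_le _ _ h, shift_cone]
      congr 2
      rw [coe_clamp (by linarith [t.2.1]) h, min_eq_left (by linarith)]
      norm_num
      ring
    · rw [thread_of_ge _ _ h, thread_of_ge _ _]
      · simp only [shift_incl, Homotopy.symm_apply]
        congr 3
        ext
        rw [coe_symm_eq, min_eq_right (by linarith), coe_clamp, coe_clamp] <;> norm_num <;>
          linarith [t.2.2]
      · rw [min_eq_right (by linarith)]
        norm_num
        linarith [t.2.2]
  · rintro ⟨a, t⟩
    simp only [ContinuousMap.comp_apply, ContinuousMap.coe_mk]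
    rw [thread_of_le _ _ (by simpa using t.2.2)]
    simp

theorem equivUnder_of_homotopic (h : f.Homotopic g) : EquivUnder (incl f) (incl g) := by
  obtain ⟨K⟩ := h
  refine ⟨⟨shift K.symm, shift K, ?_, ?_⟩, ?_⟩
  · simpa using shift_symm_comp_shift K.symm
  · exact shift_symm_comp_shift K
  · exact Homotopic.refl _

/-- The inclusion into the mapping cone is a homotopy equivalence if the domain is contractible. -/
theorem isHomotopyEquiv_incl [ContractibleSpace A] (f : C(A, X)) :
    IsHomotopyEquiv (incl f) := by
  obtain ⟨a₀, ⟨H⟩⟩ := id_nullhomotopic A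
  -- The contraction of `A` runs as the cone coordinate goes from 1 down to 0, so the apex goes to
  -- `f a₀`.
  let r : C(MappingCone f, X) := desc (ContinuousMap.id X)
    ⟨fun q => f (H (σ q.2, q.1)), by fun_prop⟩ (fun a => by simp) (fun a a' => by simp)
  -- An intermediate map between `incl f ∘ r` and the identity: it contracts `A` but keeps the cone
  -- coordinate. Pushing that coordinate to 1 gives `incl f ∘ r`; undoing the contraction gives the
  -- identity.
  let ρ : C(MappingCone f, MappingCone f) := desc (incl f)
    ⟨fun q => cone f (H (σ q.2, q.1), q.2), by fun_prop⟩
    (fun a => by simp [cone_one]) (fun a a' => by simp)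
  refine ⟨⟨incl f, r, ?_, ?_⟩, rfl⟩
  · exact Homotopic.refl _
  · refine Homotopic.trans (Homotopic.symm (?_ : Homotopic ρ _)) (Homotopic.symm ?_)
    · refine homotopic_of (ContinuousMap.curry ⟨fun q => incl f q.1, by fun_prop⟩)
        ⟨fun q => cone f (H (σ q.1.2, q.1.1), clamp (max q.1.2 q.2)), by fun_prop⟩
        ?_ ?_ ?_ ?_ ?_ ?_
      · intro a s
        have : clamp (max 1 (s : ℝ)) = 1 := clamp_of_one_le (le_max_left _ _)
        simp [this, cone_one]
      · intro a a' s
        simp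
      · intro x
        rfl
      · intro x
        rfl
      · rintro ⟨a, t⟩
        simp [ρ, max_eq_left t.2.1]
      · rintro ⟨a, t⟩
        simp [max_eq_right t.2.2, cone_one]
        rfl
    · refine homotopic_of (ContinuousMap.curry ⟨fun q => incl f q.1, by fun_prop⟩)
        ⟨fun q => cone f (H (q.2 * σ q.1.2, q.1.1), q.1.2), by fun_prop⟩
        ?_ ?_ ?_ ?_ ?_ ?_
      · intro a s
        simp [cone_one]
      · intro a a' s
        exact cone_zero f _ _
      · intro x
        rfl
      · intro x
        rfl
      · rintro ⟨a, t⟩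
        simp
      · rintro ⟨a, t⟩
        simp [ρ]

end MappingCone

end Topology

/-! ### Suspensions, the infinite ladder, and change of base points in wedges -/

section Suspension

variable {A B X Y Z P Q R : Type u} [TopologicalSpace A] [TopologicalSpace B] [TopologicalSpace X]
  [TopologicalSpace Y] [TopologicalSpace Z] [TopologicalSpace P] [TopologicalSpace Q]
  [TopologicalSpace R]

/-! ### Suspensions -/

namespace Susp

/-- The canonical map from the cylinder to the suspension. -/
def cyl (A : Type u) [TopologicalSpace A] : C(A × I, Susp A) where
  toFun q := Quot.mk _ (Sum.inl q)
  continuous_toFun := continuous_quot_mk.comp continuous_inl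

/-- The two poles of the suspension. -/
def pole (A : Type u) (b : Bool) : Susp A := Quot.mk _ (Sum.inr b)

theorem cyl_zero (a : A) : cyl A (a, 0) = pole A false := Quot.sound (SuspRel.bot a)

theorem cyl_one (a : A) : cyl A (a, 1) = pole A true := Quot.sound (SuspRel.top a)

/-- The universal property of the suspension. -/
def desc {Z : Type*} [TopologicalSpace Z] (k : C(A × I, Z)) (b : Bool → Z)
    (h0 : ∀ a, k (a, 0) = b false)
    (h1 : ∀ a, k (a, 1) = b true) : C(Susp A, Z) where
  toFun := Quot.lift (Sum.elim k b) (by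
    rintro _ _ (a | a)
    · exact h0 a
    · exact h1 a)
  continuous_toFun := continuous_quot_lift _ (k.continuous.sumElim continuous_of_discreteTopology)

theorem ind {p : Susp A → Prop} (h1 : ∀ q, p (cyl A q)) (h2 : ∀ b, p (pole A b))
    (z : Susp A) : p z := by
  obtain ⟨q | b⟩ := z
  exacts [h1 q, h2 b]

theorem map_id : Susp.map (ContinuousMap.id A) = ContinuousMap.id (Susp A) := by
  ext z
  exact ind (p := fun z => Susp.map (ContinuousMap.id A) z = z) (fun _ => rfl) (fun _ => rfl) z

theorem map_comp (f : C(A, X)) (g : C(X, Y)) :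
    Susp.map (g.comp f) = (Susp.map g).comp (Susp.map f) := by
  ext z
  exact ind (p := fun z => Susp.map (g.comp f) z = Susp.map g (Susp.map f z))
    (fun _ => rfl) (fun _ => rfl) z

/-- The suspension of a homeomorphism. -/
def mapHomeo (e : A ≃ₜ B) : Susp A ≃ₜ Susp B where
  toFun := Susp.map e
  invFun := Susp.map e.symm
  left_inv z := by
    have h : (e.symm : C(B, A)).comp (e : C(A, B)) = ContinuousMap.id A := by ext; simp
    rw [← ContinuousMap.comp_apply, ← map_comp, h, map_id]
    rfl
  right_inv z := by
    have h : (e : C(A, B)).comp (e.symm : C(B, A)) = ContinuousMap.id B := by ext; simp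
    rw [← ContinuousMap.comp_apply, ← map_comp, h, map_id]
    rfl
  continuous_toFun := (Susp.map (e : C(A, B))).continuous
  continuous_invFun := (Susp.map (e.symm : C(B, A))).continuous

instance [CompactSpace A] : CompactSpace (Susp A) :=
  inferInstanceAs (CompactSpace (Quot (SuspRel A)))

instance : Nonempty (Susp A) := ⟨pole A true⟩

instance [Nonempty A] : PathConnectedSpace (Susp A) := by
  have key : ∀ (a : A) (t : I), Joined (cyl A (a, t)) (pole A true) := fun a t =>
    ⟨⟨(cyl A).comp ⟨fun s => (a, clamp (max t s)), by fun_prop⟩,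
      by simp [max_eq_left t.2.1], by simp [max_eq_right t.2.2, cyl_one]⟩⟩
  have key' : ∀ z : Susp A, Joined z (pole A true) := by
    refine ind (fun q => key q.1 q.2) (fun b => ?_)
    cases b
    · rw [← cyl_zero (Classical.arbitrary A)]
      exact key _ _
    · exact Joined.refl _
  exact ⟨⟨pole A true⟩, fun z w => (key' z).trans (key' w).symm⟩

/-- A contraction of `A`, applied at every level, deforms the suspension into the arc over `a₀`,
which is then shrunk to its end at 0. -/
instance [ContractibleSpace A] : ContractibleSpace (Susp A) := by
  obtain ⟨a₀, ⟨H⟩⟩ := id_nullhomotopic A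
  let h : C(Susp A, I) := desc ⟨fun q : A × I => q.2, by fun_prop⟩ (fun b => if b then 1 else 0)
    (fun a => by simp) (fun a => by simp)
  let j : C(I, Susp A) := (cyl A).comp ⟨fun t => (a₀, t), by fun_prop⟩
  have hj : Homotopic (ContinuousMap.id (Susp A)) (j.comp h) := by
    let k : C((A × I) × I, Susp A) := ⟨fun q => cyl A (H (q.2, q.1.1), q.1.2), by fun_prop⟩
    let K : C(Susp A, C(I, Susp A)) := desc k.curry
      (fun b => const I (pole A b)) (fun a => by ext s; exact cyl_zero _)
      (fun a => by ext s; exact cyl_one _)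
    refine ⟨⟨K.uncurry.comp (ContinuousMap.prodSwap), fun z => ?_, fun z => ?_⟩⟩
    · refine ind (p := fun z => K z 0 = z) (fun q => ?_) (fun b => rfl) z
      change cyl A (H (0, q.1), q.2) = _
      simp
    · refine ind (p := fun z => K z 1 = j (h z)) (fun q => ?_) (fun b => ?_) z
      · change cyl A (H (1, q.1), q.2) = cyl A (a₀, q.2)
        simp
      · cases b
        · exact (cyl_zero a₀).symm
        · exact (cyl_one a₀).symm
  rw [contractible_iff_id_nullhomotopic]
  exact ⟨j 0, hj.trans ⟨⟨⟨fun q => j (σ q.1 * h q.2), by fun_prop⟩, by simp, by simp⟩⟩⟩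

end Susp

/-! ### Ladders -/

theorem isHomotopyEquiv_homeomorph (e : A ≃ₜ B) : IsHomotopyEquiv (e : C(A, B)) :=
  ⟨e.toHomotopyEquiv, rfl⟩

/-- Homeomorphisms are enough here, and by functoriality they survive suspension. -/
theorem isHomotopyEquiv_longVert : ∀ (n : ℕ) {A X Y A' X' Y' : TopCat.{u}} (a : A ≃ₜ A')
    (b : X ≃ₜ X') (c : Y ≃ₜ Y'),
    IsHomotopyEquiv (longVert n (a : C(A, A')) (b : C(X, X')) (c : C(Y, Y')))
  | 0, _, _, _, _, _, _, a, _, _ => isHomotopyEquiv_homeomorph a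
  | 1, _, _, _, _, _, _, _, b, _ => isHomotopyEquiv_homeomorph b
  | 2, _, _, _, _, _, _, _, _, c => isHomotopyEquiv_homeomorph c
  | n + 3, _, _, _, _, _, _, a, b, c =>
    isHomotopyEquiv_longVert n (A := TopCat.of _) (X := TopCat.of _) (Y := TopCat.of _)
      (A' := TopCat.of _) (X' := TopCat.of _) (Y' := TopCat.of _)
      (Susp.mapHomeo a) (Susp.mapHomeo b) (Susp.mapHomeo c)

/-- Three strictly commuting squares generate the whole ladder, since suspending them gives the next
three. -/
theorem longMap_comp_longVert : ∀ (n : ℕ) {A X Y A' X' Y' : TopCat.{u}} {f : C(A, X)} {g : C(X, Y)}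
    {h : C(Y, Susp A)} {f' : C(A', X')} {g' : C(X', Y')} {h' : C(Y', Susp A')}
    {a : C(A, A')} {b : C(X, X')} {c : C(Y, Y')} (_ : f'.comp a = b.comp f)
    (_ : g'.comp b = c.comp g) (_ : h'.comp c = (Susp.map a).comp h),
    (longMap n f' g' h').comp (longVert n a b c) =
      (longVert (n + 1) a b c).comp (longMap n f g h)
  | 0, _, _, _, _, _, _, _, _, _, _, _, _, _, _, _, h0, _, _ => h0
  | 1, _, _, _, _, _, _, _, _, _, _, _, _, _, _, _, _, h1, _ => h1
  | 2, _, _, _, _, _, _, _, _, _, _, _, _, _, _, _, _, _, h2 => h2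
  | n + 3, _, _, _, _, _, _, _, _, _, _, _, _, _, _, _, h0, h1, h2 =>
    longMap_comp_longVert n (A := TopCat.of _) (X := TopCat.of _) (Y := TopCat.of _)
      (A' := TopCat.of _) (X' := TopCat.of _) (Y' := TopCat.of _)
      ((Susp.map_comp _ _).symm.trans ((congrArg Susp.map h0).trans (Susp.map_comp _ _)))
      ((Susp.map_comp _ _).symm.trans ((congrArg Susp.map h1).trans (Susp.map_comp _ _)))
      ((Susp.map_comp _ _).symm.trans ((congrArg Susp.map h2).trans (Susp.map_comp _ _)))

/-- A homeomorphism from the mapping cone of `f` to `Y` makes `Y` the third space of a cofibre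
sequence. -/
theorem isCofibreSequence_of_homeomorph {A X Y : TopCat.{u}} (f : C(A, X)) (g : C(X, Y))
    (φ : MappingCone f ≃ₜ Y) (hφ : ∀ x, φ (MappingCone.incl f x) = g x) :
    IsCofibreSequence f g ((MappingCone.pinch f).comp (φ.symm : C(Y, MappingCone f))) := by
  refine ⟨(φ : C(MappingCone f, Y)), fun n => ⟨?_, ?_⟩⟩
  · exact isHomotopyEquiv_longVert n (Homeomorph.refl A) (Homeomorph.refl X)
      (Y := TopCat.of (MappingCone f)) φ
  · rw [longMap_comp_longVert n (Y := TopCat.of (MappingCone f)) (f := f)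
      (g := MappingCone.incl f) (h := MappingCone.pinch f)]
    · rfl
    · ext x
      exact (hφ x).symm
    · rw [Susp.map_id]
      ext x
      exact congrArg (MappingCone.pinch f) (φ.symm_apply_apply x)

/-! ### Wedges and base points -/

/-- The mapping cone of a constant map is a wedge with a suspension. -/
theorem equivUnder_incl_const [Nonempty A] (x : X) (e : Susp A ≃ₜ Y) :
    EquivUnder (MappingCone.incl (const A x)) (Wedge.inl x (e (Susp.pole A true))) := by
  let F : C(MappingCone (const A x), Wedge x (e (Susp.pole A true))) :=
    MappingCone.desc (Wedge.inl _ _)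
      ((Wedge.inr _ _).comp ((e : C(Susp A, Y)).comp (Susp.cyl A)))
      (fun a => by simpa [Susp.cyl_one] using (Wedge.glue _ _).symm)
      (fun a a' => by simp [Susp.cyl_zero])
  -- Pole `true` is the end of the cone where it is glued to `x`; pole `false` is the apex, which
  -- exists because `A` is nonempty. With `S` the map `F` gets a strict inverse.
  let S : C(Susp A, MappingCone (const A x)) := Susp.desc (MappingCone.cone _)
    (fun b => if b then MappingCone.incl _ x else MappingCone.cone _ (Classical.arbitrary A, 0))
    (fun a => MappingCone.cone_zero _ _ _) (fun a => MappingCone.cone_one _ _)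
  let G : C(Wedge x (e (Susp.pole A true)), MappingCone (const A x)) :=
    Wedge.desc (MappingCone.incl _) (S.comp (e.symm : C(Y, Susp A))) (by
      change _ = S (e.symm (e (Susp.pole A true)))
      rw [e.symm_apply_apply]
      rfl)
  have hS : ∀ z : Susp A, F (S z) = Wedge.inr _ _ (e z) := by
    refine Susp.ind (fun q => rfl) (fun b => ?_)
    cases b
    · exact congrArg (fun z => Wedge.inr _ _ (e z)) (Susp.cyl_zero _)
    · exact Wedge.glue _ _
  have hGF : G.comp F = ContinuousMap.id _ := by
    ext z
    refine MappingCone.ind (p := fun z => G (F z) = z) (fun x => rfl) (fun q => ?_) z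
    change S (e.symm (e (Susp.cyl A q))) = _
    rw [e.symm_apply_apply]
    rfl
  have hFG : F.comp G = ContinuousMap.id _ := by
    ext z
    refine Wedge.ind (p := fun z => F (G z) = z) (fun x => rfl) (fun y => ?_) z
    change F (S (e.symm y)) = _
    rw [hS, e.apply_symm_apply]
  exact ⟨⟨F, G, hGF ▸ Homotopic.refl _, hFG ▸ Homotopic.refl _⟩, Homotopic.refl _⟩

/-- The homotopy extension property of a point, up to a reparametrization of the path. -/
def PointHEP (x : X) : Prop :=
  ∀ {Z : Type u} [TopologicalSpace Z] (f : C(X, Z)) (γ : C(I, Z)), γ 0 = f x →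
    ∃ H : C(X × I, Z), (∀ q, H (q, 0) = f q) ∧
      ∃ ρ : C(I, I), ρ 0 = 0 ∧ ρ 1 = 1 ∧ ∀ s, H (x, s) = γ (ρ s)

/-- The map from a pair of points that selects a point in each of two spaces. -/
def twoPoints (x : X) (y : Y) : C(ULift.{u} Bool, X ⊕ Y) :=
  ⟨fun b => if b.down then Sum.inl x else Sum.inr y, continuous_of_discreteTopology⟩

theorem twoPoints_homotopic (x : X) {y y' : Y} (h : Joined y y') :
    (twoPoints x y).Homotopic (twoPoints x y') := by
  obtain ⟨γ⟩ := h
  refine ⟨⟨⟨fun q => if q.2.down then Sum.inl x else Sum.inr (γ q.1), ?_⟩, ?_, ?_⟩⟩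
  · rw [continuous_prod_of_discrete_right]
    rintro ⟨_ | _⟩
    · exact continuous_inr.comp γ.continuous
    · exact continuous_const
  · intro b
    simp [twoPoints]
  · intro b
    simp [twoPoints]

/-- The inclusion of `X` into the union of `X`, `Y` and a segment which joins two points. -/
def whiskerInl (x : X) (y : Y) : C(X, MappingCone (twoPoints x y)) :=
  (MappingCone.incl _).comp ⟨Sum.inl, continuous_inl⟩

/-- The inclusion of `Y` into the union of `X`, `Y` and a segment which joins two points. -/
def whiskerInr (x : X) (y : Y) : C(Y, MappingCone (twoPoints x y)) :=
  (MappingCone.incl _).comp ⟨Sum.inr, continuous_inr⟩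

/-- The path along the segment from `x` to `y`. -/
def whisker (x : X) (y : Y) : C(ℝ, MappingCone (twoPoints x y)) where
  -- The values -1, 0 and 1 of the parameter are `x`, the apex and `y`.
  toFun t := if t ≤ 0 then MappingCone.cone _ (⟨true⟩, clamp (-t))
    else MappingCone.cone _ (⟨false⟩, clamp t)
  continuous_toFun := by
    refine Continuous.if_le (by fun_prop) (by fun_prop) (by fun_prop) (by fun_prop) ?_
    rintro t rfl
    simpa using MappingCone.cone_zero _ _ _

/-- The end of the segment that belongs to an element of the pair. -/
def whiskerSign (b : ULift.{u} Bool) : ℝ := if b.down then -1 else 1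

@[fun_prop]
theorem continuous_whiskerSign : Continuous whiskerSign.{u} := continuous_of_discreteTopology

theorem whisker_sign_mul (x : X) (y : Y) (b : ULift.{u} Bool) (t : I) :
    whisker x y (whiskerSign b * t) = MappingCone.cone _ (b, t) := by
  obtain ⟨_ | _⟩ := b
  · rcases t.2.1.eq_or_lt with h | h
    · have h' : t = 0 := Subtype.ext h.symm
      subst h'
      simpa [whisker] using MappingCone.cone_zero _ _ _
    · have : ¬ (t : ℝ) ≤ 0 := not_le.2 h
      simp only [whisker, whiskerSign, ContinuousMap.coe_mk]
      simp [this]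
  · have : (0 : ℝ) ≤ t := t.2.1
    simp [whisker, whiskerSign, this]

theorem whisker_neg_one (x : X) (y : Y) : whisker x y (-1) = whiskerInl x y x := by
  have h := whisker_sign_mul x y ⟨true⟩ 1
  rw [MappingCone.cone_one] at h
  change whisker x y (-1 * 1) = whiskerInl x y x at h
  rwa [mul_one] at h

theorem whisker_one (x : X) (y : Y) : whisker x y 1 = whiskerInr x y y := by
  have h := whisker_sign_mul x y ⟨false⟩ 1
  rw [MappingCone.cone_one] at h
  change whisker x y (1 * 1) = whiskerInr x y y at h
  rwa [mul_one] at h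

/-- The segment can be collapsed because `x` is nondegenerate: the inverse of the collapse `c` comes
from extending over `X` the motion of `x` along the segment to `y`. -/
theorem equivUnder_whiskerInl {x : X} (hx : PointHEP x) (y : Y) :
    EquivUnder (whiskerInl x y) (Wedge.inl x y) := by
  let g₀ : C(X ⊕ Y, Wedge x y) := ⟨Sum.elim (Wedge.inl x y) (Wedge.inr x y),
    (Wedge.inl x y).continuous.sumElim (Wedge.inr x y).continuous⟩
  have hg₀ : ∀ b, g₀ (twoPoints x y b) = Wedge.inl x y x := by
    rintro ⟨_ | _⟩
    · exact (Wedge.glue x y).symm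
    · rfl
  let c : C(MappingCone (twoPoints x y), Wedge x y) :=
    MappingCone.desc g₀ (const _ (Wedge.inl x y x)) (fun b => (hg₀ b).symm) (fun _ _ => rfl)
  have hc : ∀ t, c (whisker x y t) = Wedge.inl x y x := by
    intro t
    by_cases h : t ≤ 0
    · simp only [whisker, ContinuousMap.coe_mk, if_pos h]
      rfl
    · simp only [whisker, ContinuousMap.coe_mk, if_neg h]
      rfl
  obtain ⟨H, H0, ρ, ρ0, ρ1, Hρ⟩ := hx (whiskerInl x y)
    ((whisker x y).comp ⟨fun t => 2 * (t : ℝ) - 1, by fun_prop⟩)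
    (by simp [whisker_neg_one])
  let d : C(Wedge x y, MappingCone (twoPoints x y)) :=
    Wedge.desc (H.comp ⟨fun q => (q, 1), by fun_prop⟩) (whiskerInr x y) (by
      simp only [ContinuousMap.comp_apply, ContinuousMap.coe_mk, Hρ, ρ1, ← whisker_one]
      norm_num)
  refine ⟨⟨c, d, ?_, ?_⟩, Homotopic.refl _⟩
  · let T : C(Y, C(I, MappingCone (twoPoints x y))) :=
      ContinuousMap.curry ⟨fun q => whiskerInr x y q.1, by fun_prop⟩
    refine Homotopic.symm (MappingCone.homotopic_of
      ⟨Sum.elim H.curry T, H.curry.continuous.sumElim T.continuous⟩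
      -- At time `s` the point `x` has been carried to the parameter `2 ρ(s) - 1`; the part of the
      -- segment below it is pushed up to this level.
      ((whisker x y).comp ⟨fun q => max (whiskerSign q.1.1 * (q.1.2 : ℝ)) (2 * (ρ q.2 : ℝ) - 1),
        by fun_prop⟩) ?_ ?_ ?_ ?_ ?_ ?_)
    · rintro ⟨_ | _⟩ s
      · have : (2 * (ρ s : ℝ) - 1) ≤ 1 := by linarith [(ρ s).2.2]
        change whisker x y (max (1 * 1) _) = whiskerInr x y y
        rw [one_mul, max_eq_left this, whisker_one]
      · have : -1 ≤ (2 * (ρ s : ℝ) - 1) := by linarith [(ρ s).2.1]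
        change whisker x y (max (-1 * 1) _) = H (x, s)
        rw [mul_one, max_eq_right this, Hρ]
        rfl
    · intro b b' s
      simp
    · rintro (q | q)
      · exact H0 q
      · rfl
    · rintro (q | q)
      · rfl
      · rfl
    · rintro ⟨b, t⟩
      have : -1 ≤ whiskerSign b * (t : ℝ) := by
        have := t.2.1
        have := t.2.2
        unfold whiskerSign
        split_ifs <;> linarith
      simp only [ContinuousMap.comp_apply, ContinuousMap.coe_mk, ρ0]
      rw [max_eq_left (by simpa using this), whisker_sign_mul]
      rfl
    · rintro ⟨b, t⟩
      have : whiskerSign b * (t : ℝ) ≤ 1 := by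
        have := t.2.1
        have := t.2.2
        unfold whiskerSign
        split_ifs <;> linarith
      simp only [ContinuousMap.comp_apply, ContinuousMap.coe_mk, ρ1]
      rw [max_eq_right (by norm_num; simpa using this)]
      change _ = H (x, 1)
      rw [Hρ, ρ1]
      rfl
  · refine Homotopic.symm (Wedge.homotopic_of (c.comp H)
      ⟨fun q => Wedge.inr x y q.1, by fun_prop⟩ ?_ ?_ ?_ ?_ ?_)
    · intro s
      simp only [ContinuousMap.comp_apply, ContinuousMap.coe_mk, Hρ, hc]
      exact Wedge.glue x y
    · intro q
      simp only [ContinuousMap.comp_apply, H0]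
      rfl
    · intro q
      rfl
    · intro q
      rfl
    · intro q
      rfl

/-- The wedge does not depend on the base point of the second summand. -/
theorem equivUnder_wedge_of_joined {x : X} (hx : PointHEP x) {y y' : Y} (h : Joined y y') :
    EquivUnder (Wedge.inl x y) (Wedge.inl x y') := by
  -- Moving the far end of the segment along a path is a homotopy of attaching maps, so only `x`,
  -- not `y`, has to be nondegenerate.
  obtain ⟨Φ, hΦ⟩ := MappingCone.equivUnder_of_homotopic (twoPoints_homotopic x h)
  have key : EquivUnder (whiskerInl x y) (whiskerInl x y') :=
    ⟨Φ, hΦ.comp (Homotopic.refl ⟨Sum.inl, continuous_inl⟩)⟩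
  exact (equivUnder_whiskerInl hx y).symm.trans (key.trans (equivUnder_whiskerInl hx y'))

end Suspension

/-! ### Independence complexes in coordinates, and nondegeneracy of their points -/

section Independence

variable {V : Type u}

/-! ### Points of independence complexes -/

/-- The support of `p` can serve as the face, which replaces the existential by conditions on
coordinates. -/
theorem mem_realization_iff [Fintype V] {G : SimpleGraph V} {p : V → ℝ} :
    p ∈ realization (indComplex G) ↔
      (∀ v, 0 ≤ p v) ∧ ∑ v, p v = 1 ∧ ∀ a b, G.Adj a b → p a = 0 ∨ p b = 0 := by
  classical
  constructor
  · rintro ⟨h, s, ⟨-, hI⟩, h0, h1⟩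
    refine ⟨h, ?_, fun a b hab => ?_⟩
    · rw [← h1]
      exact (Finset.sum_subset (Finset.subset_univ s) fun v _ hv => h0 v hv).symm
    · by_contra! hne
      have ha : a ∈ s := by_contra fun ha => hne.1 (h0 a ha)
      have hb : b ∈ s := by_contra fun hb => hne.2 (h0 b hb)
      exact hI ha hb hab.ne hab
  · rintro ⟨h, h1, hI⟩
    have hs : ∑ v ∈ Finset.univ.filter (fun v => p v ≠ 0), p v = 1 := by
      rw [Finset.sum_filter_ne_zero, h1]
    refine ⟨h, Finset.univ.filter (fun v => p v ≠ 0), ⟨?_, ?_⟩, by simp, hs⟩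
    · by_contra hne
      rw [Finset.not_nonempty_iff_eq_empty] at hne
      simp [hne] at hs
    · intro a ha b hb _ hab
      simp only [Finset.coe_filter, Finset.mem_univ, true_and, Set.mem_ofPred_eq] at ha hb
      exact (hI a b hab).elim ha hb

theorem IndSpace.nonneg {G : SimpleGraph V} (p : IndSpace G) (v : V) : 0 ≤ p.1 v := p.2.1 v

theorem IndSpace.sum_eq_one [Fintype V] {G : SimpleGraph V} (p : IndSpace G) :
    ∑ v, p.1 v = 1 := (mem_realization_iff.1 p.2).2.1

theorem IndSpace.eq_zero_or [Fintype V] {G : SimpleGraph V} (p : IndSpace G) {a b : V}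
    (h : G.Adj a b) : p.1 a = 0 ∨ p.1 b = 0 := (mem_realization_iff.1 p.2).2.2 a b h

@[fun_prop]
theorem IndSpace.continuous_coord {G : SimpleGraph V} (v : V) :
    Continuous fun p : IndSpace G => p.1 v := (continuous_apply v).comp continuous_subtype_val

/-- The realization is cut out of a cube by the closed conditions `∑ p v = 1` and `p a * p b = 0` on
edges. Compactness later turns continuous bijections into homeomorphisms. -/
instance [Finite V] (G : SimpleGraph V) : CompactSpace (IndSpace G) := by
  have := Fintype.ofFinite V
  have hK : realization (indComplex G) = (Set.univ.pi fun _ : V => Set.Icc (0 : ℝ) 1) ∩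
      {p | ∑ v, p v = 1 ∧ ∀ a b, G.Adj a b → p a * p b = 0} := by
    ext p
    rw [mem_realization_iff]
    simp only [Set.mem_inter_iff, Set.mem_pi, Set.mem_univ, true_imp_iff, Set.mem_Icc,
      Set.mem_ofPred_eq, mul_eq_zero]
    refine ⟨fun h => ⟨fun v => ⟨h.1 v, ?_⟩, h.2⟩, fun h => ⟨fun v => (h.1 v).1, h.2⟩⟩
    rw [← h.2.1]
    exact Finset.single_le_sum (fun w _ => h.1 w) (Finset.mem_univ v)
  rw [← isCompact_iff_compactSpace, hK]
  refine (isCompact_univ_pi fun _ => isCompact_Icc).inter_right ?_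
  simp only [Set.ofPred_and, Set.ofPred_forall]
  refine IsClosed.inter (isClosed_eq (by fun_prop) (by fun_prop)) ?_
  exact isClosed_iInter fun a => isClosed_iInter fun b => isClosed_iInter fun _ =>
    isClosed_eq (by fun_prop) (by fun_prop)

/-- The vertex `w` of the independence complex. -/
def vertexPoint [DecidableEq V] (G : SimpleGraph V) (w : V) : IndSpace G :=
  ⟨fun v => if v = w then 1 else 0, fun v => by positivity, {w},
    (indComplex G).singleton_mem w, by simp, by simp⟩

/-- If the support of `x` lies in that of `q`, the segment between them stays in one face. -/
theorem lineMap_mem_realization [Fintype V] {G : SimpleGraph V} (q x : IndSpace G) (θ : I)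
    (h : (θ : ℝ) ≠ 0 → ∀ v, x.1 v ≠ 0 → q.1 v ≠ 0) :
    (fun v => (1 - (θ : ℝ)) * q.1 v + θ * x.1 v) ∈ realization (indComplex G) := by
  have h1 : (0 : ℝ) ≤ 1 - θ := by linarith [θ.2.2]
  refine mem_realization_iff.2 ⟨fun v => ?_, ?_, fun a b hab => ?_⟩
  · exact add_nonneg (mul_nonneg h1 (q.nonneg v)) (mul_nonneg θ.2.1 (x.nonneg v))
  · rw [Finset.sum_add_distrib, ← Finset.mul_sum, ← Finset.mul_sum, q.sum_eq_one, x.sum_eq_one]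
    ring
  · have key : ∀ v, q.1 v = 0 → (1 - (θ : ℝ)) * q.1 v + θ * x.1 v = 0 := by
      intro v hv
      by_cases hθ : (θ : ℝ) = 0
      · simp [hv, hθ]
      · simp [hv, not_imp_not.1 (h hθ v) hv]
    exact (q.eq_zero_or hab).imp (key a) (key b)

/-- Points of independence complexes of finite graphs are nondegenerate base points. -/
theorem pointHEP [Finite V] {G : SimpleGraph V} (x : IndSpace G) : PointHEP x := by
  classical
  have := Fintype.ofFinite V
  intro Z _ f γ hγ
  -- A bump function: 1 at `x`, and nonzero only where the support of `q` contains that of `x`, so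
  -- that the segment from `q` to `x` is available.
  let m : IndSpace G → ℝ := fun q => ∏ v, if x.1 v = 0 then 1 else min 1 (q.1 v / x.1 v)
  have hm : Continuous m := by
    refine continuous_finsetProd _ fun v _ => ?_
    split_ifs
    · fun_prop
    · fun_prop
  have hfac : ∀ q : IndSpace G, ∀ v,
      0 ≤ (if x.1 v = 0 then (1 : ℝ) else min 1 (q.1 v / x.1 v)) := by
    intro q v
    split_ifs
    · exact zero_le_one
    · exact le_min zero_le_one (div_nonneg (q.nonneg v) (x.nonneg v))
  have hm0 : ∀ q, 0 ≤ m q := fun q => Finset.prod_nonneg fun v _ => hfac q v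
  have hmx : m x = 1 := by
    refine Finset.prod_eq_one fun v _ => ?_
    split_ifs with h
    · rfl
    · rw [div_self h, min_self]
  have hmq : ∀ q, m q ≠ 0 → ∀ v, x.1 v ≠ 0 → q.1 v ≠ 0 := by
    intro q hq v hv h0
    refine Finset.prod_ne_zero_iff.1 hq v (Finset.mem_univ v) ?_
    simp [hv, h0]
  let K : C(IndSpace G × I, IndSpace G) :=
    ⟨fun z => ⟨_, lineMap_mem_realization z.1 x (clamp (2 * z.2 * m z.1)) (fun h =>
      hmq z.1 (fun h0 => h (by simp [h0])))⟩, by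
      refine Continuous.subtype_mk (continuous_pi fun v => ?_) _
      have hv : Continuous fun z : IndSpace G × I => z.1.1 v :=
        (IndSpace.continuous_coord v).comp continuous_fst
      have hc : Continuous fun z : IndSpace G × I => (clamp (2 * z.2 * m z.1) : ℝ) := by fun_prop
      exact ((continuous_const.sub hc).mul hv).add (hc.mul continuous_const)⟩
  have hKx : ∀ s, K (x, s) = x := by
    intro s
    ext v
    change (1 - _) * x.1 v + _ * x.1 v = x.1 v
    ring
  -- A point is pulled straight to `x` until `2 s m(q) = 1` and follows `γ` afterwards. The point
  -- `x` itself waits during the first half, whence the reparametrization `2s - 1`.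
  refine ⟨⟨fun z => if 2 * (z.2 : ℝ) * m z.1 ≤ 1 then f (K z)
    else γ (clamp (2 * z.2 * m z.1 - 1)), ?_⟩, ?_, ⟨fun s => clamp (2 * s - 1), by fun_prop⟩,
    ?_, ?_, ?_⟩
  · refine Continuous.if_le (by fun_prop) (by fun_prop) (by fun_prop) (by fun_prop) ?_
    rintro ⟨q, s⟩ h
    have hK : K (q, s) = x := by
      ext v
      change (1 - (clamp (2 * (s : ℝ) * m q) : ℝ)) * q.1 v + clamp (2 * (s : ℝ) * m q) * x.1 v = _
      simp only at h
      simp [h]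
    simp only at h
    simp [h, hK, hγ]
  · intro q
    have : K (q, 0) = q := by
      ext v
      change (1 - (clamp (2 * ((0 : I) : ℝ) * m q) : ℝ)) * q.1 v +
        clamp (2 * ((0 : I) : ℝ) * m q) * x.1 v = _
      simp
    simp [this]
  · exact clamp_of_le_zero (by simp)
  · exact clamp_of_one_le (by norm_num)
  · intro s
    simp only [ContinuousMap.coe_mk, hmx, mul_one, hKx]
    split_ifs with h
    · rw [clamp_of_le_zero (by linarith), hγ]
    · rfl

/-- An isolated vertex can be added to any independent set, so the complex is a cone with apex `w`,
hence star-shaped. -/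
theorem contractibleSpace_of_isIsolated [Finite V] {G : SimpleGraph V} {w : V}
    (hw : G.IsIsolated w) : ContractibleSpace (IndSpace G) := by
  classical
  have := Fintype.ofFinite V
  refine StarConvex.contractibleSpace (x := (vertexPoint G w).1) ?_ ⟨_, (vertexPoint G w).2⟩
  intro p hp a b ha hb hab
  rw [mem_realization_iff] at hp
  obtain ⟨h0, h1, hI⟩ := hp
  refine mem_realization_iff.2 ⟨fun v => ?_, ?_, fun c d hcd => ?_⟩
  · exact add_nonneg (mul_nonneg ha ((vertexPoint G w).nonneg v)) (mul_nonneg hb (h0 v))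
  · simp only [Pi.add_apply, Pi.smul_apply, smul_eq_mul]
    rw [Finset.sum_add_distrib, ← Finset.mul_sum, ← Finset.mul_sum, (vertexPoint G w).sum_eq_one,
      h1, mul_one, mul_one, hab]
  · have hc : c ≠ w := by
      rintro rfl
      exact hw _ hcd
    have hd : d ≠ w := by
      rintro rfl
      exact hw _ hcd.symm
    refine (hI c d hcd).imp (fun h => ?_) (fun h => ?_)
    · simp [vertexPoint, hc, h]
    · simp [vertexPoint, hd, h]

/-! ### Induced subgraphs -/

section Induced

variable (G : SimpleGraph V) (S : Set V)

/-- The inclusion of independence complexes induced by an induced subgraph. -/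
def inclInduce : C(IndSpace (G.induce S), IndSpace G) :=
  indMap _ _ (Function.Embedding.subtype _) (fun _ _ h => h)

variable {G S}

theorem inclInduce_apply (p : IndSpace (G.induce S)) (w : S) :
    (inclInduce G S p).1 w = p.1 w :=
  (Function.Embedding.subtype (· ∈ S)).injective.extend_apply _ _ w

theorem inclInduce_apply_of_notMem (p : IndSpace (G.induce S)) {w : V} (hw : w ∉ S) :
    (inclInduce G S p).1 w = 0 :=
  Function.extend_apply' _ _ _ (by rintro ⟨a, rfl⟩; exact hw a.2)

theorem inclInduce_injective : Function.Injective (inclInduce G S) := by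
  intro p q h
  ext w
  rw [← inclInduce_apply, ← inclInduce_apply, h]

/-- A point of `Ind(G)` which is supported in `S`, as a point of the independence complex of
the induced subgraph. -/
def restrictInduce [Finite V] (p : IndSpace G) (hp : ∀ w, w ∉ S → p.1 w = 0) :
    IndSpace (G.induce S) :=
  ⟨fun w => p.1 w, by
    classical
    have := Fintype.ofFinite V
    refine mem_realization_iff.2 ⟨fun w => p.nonneg w, ?_, fun a b hab => p.eq_zero_or hab⟩
    rw [← p.sum_eq_one, ← Fintype.sum_subtype_add_sum_subtype (· ∈ S) p.1,
      Fintype.sum_eq_zero (fun w : {w // w ∉ S} => p.1 w) fun w => hp w.1 w.2, add_zero]⟩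

theorem inclInduce_restrictInduce [Finite V] (p : IndSpace G) (hp : ∀ w, w ∉ S → p.1 w = 0) :
    inclInduce G S (restrictInduce p hp) = p := by
  ext w
  by_cases hw : w ∈ S
  · exact inclInduce_apply _ ⟨w, hw⟩
  · rw [inclInduce_apply_of_notMem _ hw, hp w hw]

end Induced

end Independence

/-! ### `Ind(G - e)` as a mapping cone -/

section EdgeRemoval

variable {V : Type u} {G : SimpleGraph V} {u v : V}

/-- Edges are sorted by how they meet `{u, v}`: one condition each for those meeting it once, for
those avoiding it, and for `e`. It is applied with `H = G` and with `H = G - e`. -/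
theorem mem_realization_of_adj_le [Fintype V] (H : SimpleGraph V) (hH : H ≤ G) {p : V → ℝ}
    (h0 : ∀ w, 0 ≤ p w) (h1 : ∑ w, p w = 1)
    (hN : ∀ w, w ≠ u → w ≠ v → G.Adj u w ∨ G.Adj v w → p w = 0)
    (hI : ∀ a b, a ≠ u → a ≠ v → b ≠ u → b ≠ v → G.Adj a b → p a = 0 ∨ p b = 0)
    (huv : H.Adj u v → p u = 0 ∨ p v = 0) : p ∈ realization (indComplex H) := by
  refine mem_realization_iff.2 ⟨h0, h1, fun a b hab => ?_⟩
  have hab' := hH hab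
  by_cases hau : a = u
  · subst hau
    by_cases hbv : b = v
    · subst hbv
      exact huv hab
    · exact Or.inr (hN b hab.ne' hbv (Or.inl hab'))
  by_cases hbu : b = u
  · subst hbu
    by_cases hav : a = v
    · subst hav
      exact (huv hab.symm).symm
    · exact Or.inl (hN a hau hav (Or.inl hab'.symm))
  by_cases hav : a = v
  · subst hav
    exact Or.inr (hN b hbu hab.ne' (Or.inr hab'))
  by_cases hbv : b = v
  · subst hbv
    exact Or.inl (hN a hau hav (Or.inr hab'.symm))
  exact hI a b hau hav hbu hbv hab'

theorem mem_compl_edgeNbhd {w : V} :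
    w ∈ (edgeNbhd G u v)ᶜ ↔ w ≠ u ∧ w ≠ v ∧ ¬ (G.Adj u w ∨ G.Adj v w) := by
  simp only [edgeNbhd, closedNbhd, Set.mem_compl_iff, Set.mem_union, Set.mem_ofPred_eq]
  tauto

theorem notMem_edgeWithOutside {w : V} :
    w ∉ ({u, v} ∪ (edgeNbhd G u v)ᶜ : Set V) ↔ w ≠ u ∧ w ≠ v ∧ (G.Adj u w ∨ G.Adj v w) := by
  rw [Set.mem_union, mem_compl_edgeNbhd]
  simp only [Set.mem_insert_iff, Set.mem_singleton_iff]
  tauto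

theorem inclEdge_eq_zero (p : IndSpace (edgeWithOutside G u v)) {w : V} (hu : w ≠ u) (hv : w ≠ v)
    (h : G.Adj u w ∨ G.Adj v w) : (inclEdge G u v p).1 w = 0 :=
  inclInduce_apply_of_notMem p (notMem_edgeWithOutside.2 ⟨hu, hv, h⟩)

theorem exists_inclEdge_eq [Finite V] (p : IndSpace G)
    (h : ∀ w, w ≠ u → w ≠ v → G.Adj u w ∨ G.Adj v w → p.1 w = 0) :
    ∃ q, inclEdge G u v q = p :=
  ⟨_, inclInduce_restrictInduce p fun w hw =>
    have h' := notMem_edgeWithOutside.1 hw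
    h w h'.1 h'.2.1 h'.2.2⟩

theorem inclDelete_coe (p : IndSpace G) : (inclDelete G u v p).1 = p.1 :=
  funext fun w => (Function.Embedding.refl V).injective.extend_apply _ _ w

instance : Nonempty (IndSpace (edgeWithOutside G u v)) := by
  classical
  exact ⟨vertexPoint _ ⟨u, by simp⟩⟩

theorem deleteEdge_not_adj : ¬ (deleteEdge G u v).Adj u v := by
  simp [deleteEdge]

variable (u v) in
/-- The midpoint of the edge `e` in the realization. -/
def midpointFun [DecidableEq V] (w : V) : ℝ :=
  (if w = u then 1 / 2 else 0) + if w = v then 1 / 2 else 0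

theorem midpointFun_left [DecidableEq V] (h : u ≠ v) : midpointFun u v u = 1 / 2 := by
  simp [midpointFun, h]

theorem midpointFun_right [DecidableEq V] (h : u ≠ v) : midpointFun u v v = 1 / 2 := by
  simp [midpointFun, h.symm]

theorem midpointFun_of_ne [DecidableEq V] {w : V} (hu : w ≠ u) (hv : w ≠ v) :
    midpointFun u v w = 0 := by
  simp [midpointFun, hu, hv]

theorem sum_midpointFun [Fintype V] [DecidableEq V] : ∑ w, midpointFun u v w = 1 := by
  simp only [midpointFun, Finset.sum_add_distrib, Finset.sum_ite_eq', Finset.mem_univ, if_true]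
  norm_num

theorem midpointFun_nonneg [DecidableEq V] (w : V) : 0 ≤ midpointFun u v w := by
  unfold midpointFun
  positivity

/-- `Ind(G - e)` is the mapping cone of the inclusion of `Ind(e ⊔ (G ∖ N[e]))` into `Ind(G)`. -/
theorem exists_homeomorph_mappingCone [Finite V] (huv : G.Adj u v) :
    ∃ φ : MappingCone (inclEdge G u v) ≃ₜ IndSpace (deleteEdge G u v),
      ∀ x, φ (MappingCone.incl _ x) = inclDelete G u v x := by
  classical
  have := Fintype.ofFinite V
  have hne : u ≠ v := huv.ne
  have : CompactSpace (MappingCone (inclEdge G u v)) :=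
    inferInstanceAs (CompactSpace (Quot (ConeRel (inclEdge G u v))))
  -- The straight cone: the midpoint of `e` at `t = 0`, the base at `t = 1`.
  let k : C(IndSpace (edgeWithOutside G u v) × I, IndSpace (deleteEdge G u v)) :=
    ⟨fun z => ⟨fun w => z.2 * (inclEdge G u v z.1).1 w + (1 - z.2) * midpointFun u v w, by
      have h2 : (0 : ℝ) ≤ 1 - z.2 := by linarith [z.2.2.2]
      refine mem_realization_of_adj_le (G := G) (u := u) (v := v) _
        (SimpleGraph.deleteEdges_le _) (fun w => ?_) ?_
        (fun w hu hv h => ?_) (fun a b ha ha' hb hb' hab => ?_)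
        (fun h => absurd h deleteEdge_not_adj)
      · exact add_nonneg (mul_nonneg z.2.2.1 (IndSpace.nonneg _ w))
          (mul_nonneg h2 (midpointFun_nonneg w))
      · rw [Finset.sum_add_distrib, ← Finset.mul_sum, ← Finset.mul_sum, IndSpace.sum_eq_one,
          sum_midpointFun]
        ring
      · rw [inclEdge_eq_zero _ hu hv h, midpointFun_of_ne hu hv]
        ring
      · rw [midpointFun_of_ne ha ha', midpointFun_of_ne hb hb']
        exact ((inclEdge G u v z.1).eq_zero_or hab).imp (fun h => by rw [h]; ring)
          (fun h => by rw [h]; ring)⟩, by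
      refine Continuous.subtype_mk (continuous_pi fun w => ?_) _
      have : Continuous fun z : IndSpace (edgeWithOutside G u v) × I =>
          (inclEdge G u v z.1).1 w :=
        (IndSpace.continuous_coord w).comp ((inclEdge G u v).continuous.comp continuous_fst)
      fun_prop⟩
  have hk : ∀ a t w, (k (a, t)).1 w =
      t * (inclEdge G u v a).1 w + (1 - t) * midpointFun u v w := fun _ _ _ => rfl
  let φ : C(MappingCone (inclEdge G u v), IndSpace (deleteEdge G u v)) :=
    MappingCone.desc (inclDelete G u v) k
      (fun a => by
        ext w
        rw [hk, inclDelete_coe]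
        simp)
      (fun a a' => by
        ext w
        rw [hk, hk]
        simp)
  have hpos : ∀ a t, t ≠ 1 → (k (a, t)).1 u ≠ 0 ∧ (k (a, t)).1 v ≠ 0 := by
    intro a t ht
    have ht' : (t : ℝ) < 1 := lt_of_le_of_ne t.2.2 fun h => ht (Subtype.ext h)
    have h1 := mul_nonneg t.2.1 ((inclEdge G u v a).nonneg u)
    have h2 := mul_nonneg t.2.1 ((inclEdge G u v a).nonneg v)
    rw [hk, hk, midpointFun_left hne, midpointFun_right hne]
    constructor <;> apply ne_of_gt <;> linarith
  -- The base point vanishes at `u` or at `v`, so the smaller coordinate comes from the midpoint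
  -- alone and determines `t`.
  have hmin : ∀ a t, min ((k (a, t)).1 u) ((k (a, t)).1 v) = (1 - t) / 2 := by
    intro a t
    have h1 := mul_nonneg t.2.1 ((inclEdge G u v a).nonneg u)
    have h2 := mul_nonneg t.2.1 ((inclEdge G u v a).nonneg v)
    rw [hk, hk, midpointFun_left hne, midpointFun_right hne]
    rcases (inclEdge G u v a).eq_zero_or huv with h | h
    · rw [h] at h1 ⊢
      rw [min_eq_left (by linarith)]
      ring
    · rw [h] at h2 ⊢
      rw [min_eq_right (by linarith)]
      ring
  have hrep : ∀ z, (∃ x, z = MappingCone.incl (inclEdge G u v) x) ∨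
      ∃ a t, t ≠ 1 ∧ z = MappingCone.cone (inclEdge G u v) (a, t) := by
    refine MappingCone.ind (fun x => Or.inl ⟨x, rfl⟩) (fun q => ?_)
    obtain ⟨a, t⟩ := q
    by_cases ht : t = 1
    · exact Or.inl ⟨_, by rw [ht, MappingCone.cone_one]⟩
    · exact Or.inr ⟨a, t, ht, rfl⟩
  have hdisj : ∀ x a t, t ≠ 1 → φ (MappingCone.incl _ x) ≠ φ (MappingCone.cone _ (a, t)) := by
    intro x a t ht h
    change inclDelete G u v x = k (a, t) at h
    have hx := x.eq_zero_or huv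
    rw [← inclDelete_coe (u := u) (v := v), h] at hx
    exact hx.elim (hpos a t ht).1 (hpos a t ht).2
  have hinj : Function.Injective φ := by
    intro z z' h
    rcases hrep z with ⟨x, rfl⟩ | ⟨a, t, ht, rfl⟩ <;>
      rcases hrep z' with ⟨x', rfl⟩ | ⟨a', t', ht', rfl⟩
    · congr 1
      change inclDelete G u v x = inclDelete G u v x' at h
      ext w
      rw [← inclDelete_coe (u := u) (v := v), h, inclDelete_coe]
    · exact absurd h (hdisj _ _ _ ht')
    · exact absurd h.symm (hdisj _ _ _ ht)
    · change k (a, t) = k (a', t') at h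
      have htt : t = t' := by
        have := hmin a t
        rw [h, hmin] at this
        ext
        linarith
      subst htt
      by_cases ht0 : t = 0
      · rw [ht0]
        exact MappingCone.cone_zero _ _ _
      · have ht0' : (t : ℝ) ≠ 0 := fun h => ht0 (Subtype.ext h)
        congr 2
        refine inclInduce_injective (Subtype.ext (funext fun w => ?_))
        have hw := congrFun (congrArg Subtype.val h) w
        rw [hk, hk] at hw
        exact mul_left_cancel₀ ht0' (add_right_cancel hw)
  have hsurj : Function.Surjective φ := by
    intro y
    have hy : ∀ a b, G.Adj a b → s(a, b) ≠ s(u, v) → y.1 a = 0 ∨ y.1 b = 0 := fun a b hab h =>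
      y.eq_zero_or (by simpa [deleteEdge, hab] using h)
    have hI : ∀ a b, a ≠ u → a ≠ v → G.Adj a b → y.1 a = 0 ∨ y.1 b = 0 := by
      intro a b hau hav hab
      refine hy a b hab fun h => ?_
      rcases Sym2.eq_iff.1 h with h | h
      · exact hau h.1
      · exact hav h.1
    by_cases h0 : y.1 u = 0 ∨ y.1 v = 0
    · have hmem : y.1 ∈ realization (indComplex G) := by
        refine mem_realization_iff.2 ⟨y.nonneg, y.sum_eq_one, fun a b hab => ?_⟩
        by_cases h : s(a, b) = s(u, v)
        · rcases Sym2.eq_iff.1 h with ⟨rfl, rfl⟩ | ⟨rfl, rfl⟩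
          · exact h0
          · exact h0.symm
        · exact hy a b hab h
      refine ⟨MappingCone.incl _ ⟨y.1, hmem⟩, Subtype.ext ?_⟩
      exact inclDelete_coe _
    · rw [not_or] at h0
      have hN : ∀ w, w ≠ u → w ≠ v → G.Adj u w ∨ G.Adj v w → y.1 w = 0 := by
        rintro w hu hv (h | h)
        · exact (hI w u hu hv h.symm).resolve_right h0.1
        · exact (hI w v hu hv h.symm).resolve_right h0.2
      have hS : ∑ w ∈ {u, v}, y.1 w = y.1 u + y.1 v := Finset.sum_pair hne
      have hle : y.1 u + y.1 v ≤ 1 := by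
        rw [← hS, ← y.sum_eq_one]
        exact Finset.sum_le_univ_sum_of_nonneg y.nonneg
      obtain ⟨μ, hμ⟩ : ∃ μ, min (y.1 u) (y.1 v) = μ := ⟨_, rfl⟩
      have hμ0 : 0 ≤ μ := hμ ▸ le_min (y.nonneg u) (y.nonneg v)
      have hμu : μ ≤ y.1 u := hμ ▸ min_le_left _ _
      have hμv : μ ≤ y.1 v := hμ ▸ min_le_right _ _
      -- If `μ = 1/2`, all the mass of `y` sits at `u` and `v` in equal parts: `y` is the apex, and
      -- any `a` represents it.
      by_cases ht : 1 - 2 * μ = 0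
      · obtain ⟨a⟩ : Nonempty (IndSpace (edgeWithOutside G u v)) := inferInstance
        refine ⟨MappingCone.cone _ (a, 0), Subtype.ext (funext fun w => ?_)⟩
        change (k (a, 0)).1 w = y.1 w
        rw [hk]
        by_cases hwu : w = u
        · subst hwu
          rw [midpointFun_left hne]
          norm_num
          linarith
        by_cases hwv : w = v
        · subst hwv
          rw [midpointFun_right hne]
          norm_num
          linarith
        rw [midpointFun_of_ne hwu hwv]
        have h3 : ∑ x ∈ {w, u, v}, y.1 x = y.1 w + (y.1 u + y.1 v) := by
          rw [Finset.sum_insert (by simp [hwu, hwv]), hS]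
        have h4 : ∑ x ∈ {w, u, v}, y.1 x ≤ 1 := by
          rw [← y.sum_eq_one]
          exact Finset.sum_le_univ_sum_of_nonneg y.nonneg
        have := y.nonneg w
        norm_num
        linarith
      · have ht0 : 0 < 1 - 2 * μ := lt_of_le_of_ne (by linarith) (Ne.symm ht)
        -- Chosen so that `y = (1 - 2μ) p + 2μ · midpoint`. Since `μ` is the smaller coordinate, `p`
        -- is nonnegative and vanishes at `u` or `v`, so it respects `e`.
        let p : V → ℝ := fun w => (y.1 w - 2 * μ * midpointFun u v w) / (1 - 2 * μ)
        have hp : ∀ w, p w = (y.1 w - 2 * μ * midpointFun u v w) / (1 - 2 * μ) := fun _ => rfl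
        have hpne : ∀ w, w ≠ u → w ≠ v → y.1 w = 0 → p w = 0 := by
          intro w hu hv h
          rw [hp, midpointFun_of_ne hu hv, h]
          simp
        have hpm : p ∈ realization (indComplex G) := by
          refine mem_realization_of_adj_le (G := G) (u := u) (v := v) _ le_rfl (fun w => ?_) ?_
            (fun w hu hv h => hpne w hu hv (hN w hu hv h)) (fun a b ha ha' hb hb' hab => ?_)
            (fun _ => ?_)
          · refine div_nonneg ?_ ht0.le
            by_cases hwu : w = u
            · subst hwu
              rw [midpointFun_left hne]
              linarith
            by_cases hwv : w = v
            · subst hwv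
              rw [midpointFun_right hne]
              linarith
            rw [midpointFun_of_ne hwu hwv]
            linarith [y.nonneg w]
          · simp only [hp]
            rw [← Finset.sum_div, Finset.sum_sub_distrib, ← Finset.mul_sum, y.sum_eq_one,
              sum_midpointFun, mul_one, div_self ht]
          · exact (hI a b ha ha' hab).imp (hpne a ha ha') (hpne b hb hb')
          · rw [hp, hp, midpointFun_left hne, midpointFun_right hne]
            rcases min_choice (y.1 u) (y.1 v) with h | h
            · left
              rw [← h, hμ, div_eq_zero_iff]
              exact Or.inl (by ring)
            · right
              rw [← h, hμ, div_eq_zero_iff]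
              exact Or.inl (by ring)
        obtain ⟨a, ha⟩ := exists_inclEdge_eq (u := u) (v := v) ⟨p, hpm⟩
          (fun w hu hv h => hpne w hu hv (hN w hu hv h))
        refine ⟨MappingCone.cone _ (a, ⟨1 - 2 * μ, ht0.le, by linarith⟩),
          Subtype.ext (funext fun w => ?_)⟩
        change (k (a, _)).1 w = y.1 w
        rw [hk, ha]
        change (1 - 2 * μ) * ((y.1 w - 2 * μ * midpointFun u v w) / (1 - 2 * μ)) +
          (1 - (1 - 2 * μ)) * midpointFun u v w = y.1 w
        rw [mul_div_cancel₀ _ ht]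
        ring
  -- A continuous bijection from a compact space to a Hausdorff space is a homeomorphism.
  exact ⟨(isHomeomorph_iff_continuous_bijective.2
    ⟨φ.continuous, hinj, hsurj⟩).homeomorph, fun x => rfl⟩

end EdgeRemoval

/-! ### `Ind(e ⊔ (G ∖ N[e]))` as a suspension; parts (a) and (b) -/

section EdgeSuspension

variable {V : Type u} {G : SimpleGraph V} {u v : V}

/-- `Ind(e ⊔ (G ∖ N[e]))` is the suspension of `Ind(G ∖ N[e])`. -/
theorem exists_homeomorph_susp [Finite V] (huv : G.Adj u v) :
    Nonempty (Susp (IndSpace (outside G u v)) ≃ₜ IndSpace (edgeWithOutside G u v)) := by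
  classical
  have := Fintype.ofFinite V
  have hne : u ≠ v := huv.ne
  let ι : C(IndSpace (outside G u v), IndSpace G) := inclInduce G (edgeNbhd G u v)ᶜ
  have hιu : ∀ b, (ι b).1 u = 0 := fun b =>
    inclInduce_apply_of_notMem b fun hw => (mem_compl_edgeNbhd.1 hw).1 rfl
  have hιv : ∀ b, (ι b).1 v = 0 := fun b =>
    inclInduce_apply_of_notMem b fun hw => (mem_compl_edgeNbhd.1 hw).2.1 rfl
  have hιN : ∀ b w, G.Adj u w ∨ G.Adj v w → (ι b).1 w = 0 := fun b w h =>
    inclInduce_apply_of_notMem b fun hw => (mem_compl_edgeNbhd.1 hw).2.2 h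
  let P : ℝ → ℝ → V → ℝ := fun α β w => (if w = u then α else 0) + if w = v then β else 0
  have hPu : ∀ α β, P α β u = α := fun α β => by simp [P, hne]
  have hPv : ∀ α β, P α β v = β := fun α β => by simp [P, hne.symm]
  have hPw : ∀ α β w, w ≠ u → w ≠ v → P α β w = 0 := fun α β w hu hv => by simp [P, hu, hv]
  have hPsum : ∀ α β, ∑ w, P α β w = α + β := fun α β => by
    simp only [P, Finset.sum_add_distrib, Finset.sum_ite_eq', Finset.mem_univ, if_true]
  -- The level `t` runs from `u` at 0 through `Ind(G ∖ N[e])` at 1/2 to `v` at 1. The values are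
  -- taken in `Ind(G)` and corestricted later in `Ψ`.
  let k : C(IndSpace (outside G u v) × I, IndSpace G) :=
    ⟨fun z => ⟨fun w => P (max 0 (1 - 2 * z.2)) (max 0 (2 * z.2 - 1)) w +
        (1 - |2 * (z.2 : ℝ) - 1|) * (ι z.1).1 w, by
      obtain ⟨b, t, ht0, ht1⟩ := z
      have h1 : 0 ≤ 1 - |2 * t - 1| := by
        rw [sub_nonneg, abs_le]
        constructor <;> linarith
      refine mem_realization_of_adj_le (G := G) (u := u) (v := v) _ le_rfl (fun w => ?_) ?_
        (fun w hu hv h => ?_) (fun a c ha ha' hc hc' hac => ?_) (fun _ => ?_)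
      · refine add_nonneg ?_ (mul_nonneg h1 ((ι b).nonneg w))
        simp only [P]
        positivity
      · rw [Finset.sum_add_distrib, ← Finset.mul_sum, IndSpace.sum_eq_one, hPsum]
        rcases le_total (2 * t) 1 with h | h
        · rw [max_eq_right (by linarith), max_eq_left (by linarith), abs_of_nonpos (by linarith)]
          ring
        · rw [max_eq_left (by linarith), max_eq_right (by linarith), abs_of_nonneg (by linarith)]
          ring
      · rw [hPw _ _ _ hu hv, hιN b w h]
        ring
      · rw [hPw _ _ _ ha ha', hPw _ _ _ hc hc']
        exact ((ι b).eq_zero_or hac).imp (fun h => by rw [h]; ring) (fun h => by rw [h]; ring)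
      · rw [hPu, hPv, hιu, hιv]
        rcases le_total (2 * t) 1 with h | h
        · right
          simpa using h
        · left
          simpa using h⟩, by
      refine Continuous.subtype_mk (continuous_pi fun w => ?_) _
      have : Continuous fun z : IndSpace (outside G u v) × I => (ι z.1).1 w :=
        (IndSpace.continuous_coord w).comp (ι.continuous.comp continuous_fst)
      refine Continuous.add (Continuous.add ?_ ?_) (Continuous.mul (by fun_prop) this)
      · split_ifs <;> fun_prop
      · split_ifs <;> fun_prop⟩
  have hk : ∀ b t w, (k (b, t)).1 w = P (max 0 (1 - 2 * t)) (max 0 (2 * t - 1)) w +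
      (1 - |2 * (t : ℝ) - 1|) * (ι b).1 w := fun _ _ _ => rfl
  let ψ : C(Susp (IndSpace (outside G u v)), IndSpace G) :=
    Susp.desc k (fun i => if i then vertexPoint G v else vertexPoint G u)
      (fun b => by
        ext w
        rw [hk]
        norm_num [P, vertexPoint])
      (fun b => by
        ext w
        rw [hk]
        norm_num [P, vertexPoint])
  have hsupp : ∀ z w, w ∉ ({u, v} ∪ (edgeNbhd G u v)ᶜ : Set V) → (ψ z).1 w = 0 := by
    intro z w hw
    obtain ⟨hu, hv, hN⟩ := notMem_edgeWithOutside.1 hw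
    refine Susp.ind (p := fun z => (ψ z).1 w = 0) (fun q => ?_) (fun i => ?_) z
    · change (k (q.1, q.2)).1 w = 0
      rw [hk, hPw _ _ _ hu hv, hιN _ _ hN]
      ring
    · cases i
      · exact if_neg hu
      · exact if_neg hv
  let Ψ : C(Susp (IndSpace (outside G u v)), IndSpace (edgeWithOutside G u v)) :=
    ⟨fun z => restrictInduce (ψ z) (hsupp z), Continuous.subtype_mk
      (continuous_pi fun w : ↥({u, v} ∪ (edgeNbhd G u v)ᶜ : Set V) =>
        (IndSpace.continuous_coord w.1).comp ψ.continuous) _⟩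
  have hΨ : ∀ z, inclEdge G u v (Ψ z) = ψ z := fun z => inclInduce_restrictInduce (ψ z) (hsupp z)
  -- This difference equals `2t - 1`, so it recovers the suspension coordinate and separates the
  -- poles.
  let height : Susp (IndSpace (outside G u v)) → ℝ := fun z => (ψ z).1 v - (ψ z).1 u
  have hheight : ∀ b t, height (Susp.cyl _ (b, t)) = 2 * t - 1 := by
    intro b t
    change (k (b, t)).1 v - (k (b, t)).1 u = _
    rw [hk, hk, hPu, hPv, hιu, hιv]
    rcases le_total (2 * (t : ℝ)) 1 with h | h
    · rw [max_eq_left (by linarith), max_eq_right (by linarith)]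
      ring
    · rw [max_eq_right (by linarith), max_eq_left (by linarith)]
      ring
  have hheight' : ∀ i, height (Susp.pole _ i) = if i then 1 else -1 := by
    intro i
    cases i
    · change (vertexPoint G u).1 v - (vertexPoint G u).1 u = _
      simp [vertexPoint, hne.symm]
    · change (vertexPoint G v).1 v - (vertexPoint G v).1 u = _
      simp [vertexPoint, hne]
  have hrep : ∀ z, (∃ i, z = Susp.pole (IndSpace (outside G u v)) i) ∨
      ∃ (b : IndSpace (outside G u v)) (t : I), 0 < (t : ℝ) ∧ (t : ℝ) < 1 ∧
        z = Susp.cyl _ (b, t) := by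
    refine Susp.ind (fun q => ?_) (fun i => Or.inl ⟨i, rfl⟩)
    obtain ⟨b, t⟩ := q
    rcases t.2.1.eq_or_lt with h | h
    · have : t = 0 := Subtype.ext h.symm
      exact Or.inl ⟨false, by rw [this, Susp.cyl_zero]⟩
    rcases t.2.2.eq_or_lt with h' | h'
    · have : t = 1 := Subtype.ext h'
      exact Or.inl ⟨true, by rw [this, Susp.cyl_one]⟩
    exact Or.inr ⟨b, t, h, h', rfl⟩
  have hinj : Function.Injective Ψ := by
    intro z z' h
    have hψ : ψ z = ψ z' := by rw [← hΨ, h, hΨ]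
    have hh : height z = height z' := by simp only [height, hψ]
    rcases hrep z with ⟨i, rfl⟩ | ⟨b, t, h0, h1, rfl⟩ <;>
      rcases hrep z' with ⟨i', rfl⟩ | ⟨b', t', h0', h1', rfl⟩
    · rw [hheight', hheight'] at hh
      cases i <;> cases i' <;> first | rfl | norm_num at hh
    · rw [hheight, hheight'] at hh
      cases i <;> simp only [Bool.false_eq_true, if_false, if_true] at hh <;> linarith
    · rw [hheight, hheight'] at hh
      cases i' <;> simp only [Bool.false_eq_true, if_false, if_true] at hh <;> linarith
    · rw [hheight, hheight] at hh
      have htt : t = t' := by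
        ext
        linarith
      subst htt
      congr 2
      refine inclInduce_injective (Subtype.ext (funext fun w => ?_))
      have hw : (k (b, t)).1 w = (k (b', t)).1 w := congrFun (congrArg Subtype.val hψ) w
      rw [hk, hk] at hw
      refine mul_left_cancel₀ (ne_of_gt ?_) (add_left_cancel hw)
      rw [sub_pos, abs_lt]
      constructor <;> linarith
  have hsurj : Function.Surjective Ψ := by
    suffices h : ∀ a, ∃ z, ψ z = inclEdge G u v a by
      intro a
      obtain ⟨z, hz⟩ := h a
      exact ⟨z, inclInduce_injective ((hΨ z).trans hz)⟩
    intro a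
    obtain ⟨y, hy⟩ : ∃ y, inclEdge G u v a = y := ⟨_, rfl⟩
    have hyN : ∀ w, w ≠ u → w ≠ v → G.Adj u w ∨ G.Adj v w → y.1 w = 0 := fun w hu hv h =>
      hy ▸ inclEdge_eq_zero a hu hv h
    rw [hy]
    have hrest : ∑ w, (y.1 w - P (y.1 u) (y.1 v) w) = 1 - (y.1 u + y.1 v) := by
      rw [Finset.sum_sub_distrib, y.sum_eq_one, hPsum]
    have hrest0 : ∀ w, 0 ≤ y.1 w - P (y.1 u) (y.1 v) w := by
      intro w
      by_cases hu : w = u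
      · rw [hu, hPu, sub_self]
      by_cases hv : w = v
      · rw [hv, hPv, sub_self]
      rw [hPw _ _ _ hu hv, sub_zero]
      exact y.nonneg w
    have hle : 0 ≤ 1 - (y.1 u + y.1 v) := hrest ▸ Finset.sum_nonneg fun w _ => hrest0 w
    -- Without mass off `e` the point is the vertex `u` or `v`, that is, a pole. Otherwise the
    -- rescaled rest of `y` is a point of `Ind(G ∖ N[e])`, and `t` is found by solving `2t - 1 = y v
    -- - y u`.
    by_cases h1 : 1 - (y.1 u + y.1 v) = 0
    · have hw : ∀ w, y.1 w = P (y.1 u) (y.1 v) w := fun w => by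
        have := (Finset.sum_eq_zero_iff_of_nonneg fun w _ => hrest0 w).1 (hrest.trans h1) w
          (Finset.mem_univ w)
        linarith
      rcases y.eq_zero_or huv with h | h
      · refine ⟨Susp.pole _ true, Subtype.ext (funext fun w => ?_)⟩
        rw [hw, h, (by linarith : y.1 v = 1)]
        change (if w = v then (1 : ℝ) else 0) = _
        simp [P]
      · refine ⟨Susp.pole _ false, Subtype.ext (funext fun w => ?_)⟩
        rw [hw, h, (by linarith : y.1 u = 1)]
        change (if w = u then (1 : ℝ) else 0) = _
        simp [P]
    · have hpos : 0 < 1 - (y.1 u + y.1 v) := lt_of_le_of_ne hle (Ne.symm h1)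
      let p : V → ℝ := fun w => (y.1 w - P (y.1 u) (y.1 v) w) / (1 - (y.1 u + y.1 v))
      have hp : ∀ w, p w = (y.1 w - P (y.1 u) (y.1 v) w) / (1 - (y.1 u + y.1 v)) := fun _ => rfl
      have hp0 : ∀ w, y.1 w = 0 → p w = 0 := by
        intro w h
        rw [hp]
        by_cases hu : w = u
        · rw [hu, hPu, sub_self, zero_div]
        by_cases hv : w = v
        · rw [hv, hPv, sub_self, zero_div]
        rw [h, hPw _ _ _ hu hv, sub_zero, zero_div]
      have hpm : p ∈ realization (indComplex G) := by
        refine mem_realization_iff.2 ⟨fun w => div_nonneg (hrest0 w) hle, ?_, fun a b hab =>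
          (y.eq_zero_or hab).imp (hp0 a) (hp0 b)⟩
        simp only [hp]
        rw [← Finset.sum_div, hrest, div_self h1]
      have hpN : ∀ w, w ∉ (edgeNbhd G u v)ᶜ → p w = 0 := by
        intro w hw
        by_cases hu : w = u
        · rw [hp, hu, hPu, sub_self, zero_div]
        by_cases hv : w = v
        · rw [hp, hv, hPv, sub_self, zero_div]
        rw [mem_compl_edgeNbhd] at hw
        exact hp0 w (hyN w hu hv (by tauto))
      have hu0 := y.nonneg u
      have hv0 := y.nonneg v
      refine ⟨Susp.cyl _ (restrictInduce ⟨p, hpm⟩ hpN,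
        ⟨(1 + y.1 v - y.1 u) / 2, by linarith, by linarith⟩), Subtype.ext (funext fun w => ?_)⟩
      change (k (_, _)).1 w = _
      rw [hk, inclInduce_restrictInduce]
      change P _ _ w + _ * ((y.1 w - P (y.1 u) (y.1 v) w) / (1 - (y.1 u + y.1 v))) = _
      simp only
      rcases y.eq_zero_or huv with h | h
      · rw [h] at h1 ⊢
        rw [max_eq_left (by linarith), max_eq_right (by linarith), abs_of_nonneg (by linarith)]
        have h2 : 2 * ((1 + y.1 v - 0) / 2) - 1 = y.1 v := by ring
        rw [h2]
        rw [zero_add] at h1 ⊢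
        rw [mul_div_cancel₀ _ h1]
        ring
      · rw [h] at h1 ⊢
        rw [max_eq_right (by linarith), max_eq_left (by linarith), abs_of_nonpos (by linarith)]
        have h2 : 1 - 2 * ((1 + 0 - y.1 u) / 2) = y.1 u := by ring
        have h3 : 1 - -(2 * ((1 + 0 - y.1 u) / 2) - 1) = 1 - y.1 u := by ring
        rw [h2, h3]
        rw [add_zero] at h1 ⊢
        rw [mul_div_cancel₀ _ h1]
        ring
  exact ⟨(isHomeomorph_iff_continuous_bijective.2
    ⟨Ψ.continuous, hinj, hsurj⟩).homeomorph⟩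

theorem isHomotopyEquiv_inclDelete [Finite V] (huv : G.Adj u v)
    (h : ContractibleSpace (IndSpace (outside G u v))) :
    IsHomotopyEquiv (inclDelete G u v) := by
  obtain ⟨e⟩ := exists_homeomorph_susp huv
  obtain ⟨φ, hφ⟩ := exists_homeomorph_mappingCone huv
  have : ContractibleSpace (IndSpace (edgeWithOutside G u v)) := e.symm.contractibleSpace
  obtain ⟨Φ, hΦ⟩ := MappingCone.isHomotopyEquiv_incl (inclEdge G u v)
  refine ⟨Φ.trans φ.toHomotopyEquiv, ?_⟩
  ext1 x
  rw [← hφ, ← hΦ]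
  rfl

/-- If the inclusion of `Ind(e ⊔ (G ∖ N[e]))` is null-homotopic, then `Ind(G - e)` splits. -/
theorem equivUnder_wedge_inclDelete [Finite V] (huv : G.Adj u v)
    (h : (inclEdge G u v).Nullhomotopic) (x : IndSpace G)
    (y : Susp (Susp (IndSpace (outside G u v)))) (hx : ∃ p, Joined (inclEdge G u v p) x) :
    EquivUnder (Wedge.inl x y) (inclDelete G u v) := by
  obtain ⟨e⟩ := exists_homeomorph_susp huv
  obtain ⟨φ, hφ⟩ := exists_homeomorph_mappingCone huv
  obtain ⟨z, ⟨H⟩⟩ := h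
  obtain ⟨p, hp⟩ := hx
  -- The track of `p` under the null-homotopy joins its image to `z`; hence `z` can be replaced by
  -- the prescribed base point `x`.
  have hz : Joined (inclEdge G u v p) z := ⟨⟨⟨fun t => H (t, p), by fun_prop⟩, by simp, by simp⟩⟩
  obtain ⟨γ⟩ := hz.symm.trans hp
  have hconst : (inclEdge G u v).Homotopic (const _ x) :=
    Homotopic.trans ⟨H⟩ ⟨⟨⟨fun q => γ q.1, by fun_prop⟩, by simp, by simp⟩⟩
  -- A suspension is never empty, so the double suspension is path connected even when `Ind(G ∖
  -- N[e])` is empty, and `y` can be moved to the pole used by the cone of the constant map.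
  have h1 := equivUnder_wedge_of_joined (pointHEP x)
    (PathConnectedSpace.joined y (Susp.mapHomeo e.symm (Susp.pole _ true)))
  have h2 := (equivUnder_incl_const x (Susp.mapHomeo e.symm)).symm
  have h3 := (MappingCone.equivUnder_of_homotopic hconst).symm
  have h4 : EquivUnder (MappingCone.incl (inclEdge G u v)) (inclDelete G u v) := by
    refine ⟨φ.toHomotopyEquiv, ?_⟩
    have : φ.toHomotopyEquiv.toFun.comp (MappingCone.incl _) = inclDelete G u v := by
      ext1 x
      exact hφ x
    rw [this]
  exact h1.trans (h2.trans (h3.trans h4))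

end EdgeSuspension

end IndCx

end

theorem mainTheorem8 {V : Type*} [Finite V] (G : SimpleGraph V) (u v : V) (huv : G.Adj u v) :
    -- the cofibre sequence
    (∃ δ : C(IndCx.IndSpace (IndCx.deleteEdge G u v),
          IndCx.Susp (IndCx.IndSpace (IndCx.edgeWithOutside G u v))),
      IndCx.IsCofibreSequence
        (A := TopCat.of (IndCx.IndSpace (IndCx.edgeWithOutside G u v)))
        (X := TopCat.of (IndCx.IndSpace G))
        (Y := TopCat.of (IndCx.IndSpace (IndCx.deleteEdge G u v)))
        (IndCx.inclEdge G u v) (IndCx.inclDelete G u v) δ) ∧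
    -- part (a)
    (ContractibleSpace (IndCx.IndSpace (IndCx.outside G u v)) →
      IndCx.IsHomotopyEquiv (IndCx.inclDelete G u v)) ∧
    -- removal of isolating edges
    (IndCx.IsIsolatingEdge G u v → IndCx.IsHomotopyEquiv (IndCx.inclDelete G u v)) ∧
    -- part (b), for every admissible choice of base points
    ((IndCx.inclEdge G u v).Nullhomotopic →
      ∀ (x : IndCx.IndSpace G) (y : IndCx.Susp (IndCx.Susp (IndCx.IndSpace (IndCx.outside G u v)))),
        (∃ p, Joined (IndCx.inclEdge G u v p) x) →
        ∃ Φ : ContinuousMap.HomotopyEquiv (IndCx.Wedge x y)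
            (IndCx.IndSpace (IndCx.deleteEdge G u v)),
          (Φ.toFun.comp (IndCx.Wedge.inl x y)).Homotopic (IndCx.inclDelete G u v)) := by
  refine ⟨?_, IndCx.isHomotopyEquiv_inclDelete huv, fun h => ?_,
    fun h x y hx => IndCx.equivUnder_wedge_inclDelete huv h x y hx⟩
  · obtain ⟨φ, hφ⟩ := IndCx.exists_homeomorph_mappingCone huv
    exact ⟨_, IndCx.isCofibreSequence_of_homeomorph
      (A := TopCat.of (IndCx.IndSpace (IndCx.edgeWithOutside G u v)))
      (X := TopCat.of (IndCx.IndSpace G))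
      (Y := TopCat.of (IndCx.IndSpace (IndCx.deleteEdge G u v))) _ _ φ hφ⟩
  · obtain ⟨-, w, hw⟩ := h
    exact IndCx.isHomotopyEquiv_inclDelete huv (IndCx.contractibleSpace_of_isIsolated hw)
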